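/- **Theorem 3.2** (Asynchronous products do not preserve the decidability of the FO(Reg)-theory). There are two pushdown graphs, each with a decidable FO(Reg)-theory, whose asynchronous product has an undecidable FO(Reg)-theory. Here a transition system over a finite label set $\Sigma$ is a directed graph $G=(V,(E_a)_{a\in\Sigma})$ with $E_a\subseteq V\times V$. A pushdown automaton consists of a finite state set $Q$, a finite input alphabet $\Sigma$, a finite stack alphabet $\Gamma$, an initial state $q_0$ and a transition relation $\Delta\subseteq Q\times\Sigma\times(\Gamma\cup\{\epsilon\})\times(\Gamma\cup\{\epsilon\})\times Q$; final states play no role for its graph. The pushdown graph it generates has as vertices the configurations in $Q\times\Gamma^*$ that are reachable from $(q_0,\epsilon)$, and it has an $a$-labeled edge from $(q,\gamma u)$ to $(p,\gamma' u)$ for every $(q,a,\gamma,\gamma',p)\in\Delta$ and $u\in\Gamma^*$ for which $(q,\gamma u)$ is a vertex. The asynchronous product of $G_1=(V_1,(E^1_a)_{a\in\Sigma_1})$ and $G_2=(V_2,(E^2_a)_{a\in\Sigma_2})$, where $\Sigma_1$ and $\Sigma_2$ are disjoint, is the graph with vertex set $V_1\times V_2$ and label set $\Sigma_1\cup\Sigma_2$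 that has an $a$-labeled edge from $(v_1,v_2)$ to $(w_1,w_2)$ iff either $a\in\Sigma_1$, $(v_1,w_1)\in E^1_a$ and $v_2=w_2$, or $a\in\Sigma_2$, $(v_2,w_2)\in E^2_a$ and $v_1=w_1$. FO(Reg) is first-order logic with equality over the edge relations $E_a$, $a\in\Sigma$, extended by the predicates $\mathrm{Reach}_r(x,y)$ for regular expressions $r$ over $\Sigma$; $\mathrm{Reach}_r(v,w)$ holds if some path from $v$ to $w$ is labeled by a word in the language described by $r$. The FO(Reg)-theory of $G$ is decidable if there is an algorithm that, given an FO(Reg)-sentence, decides whether it is true in $G$. -/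

import Mathlib

namespace FOReg

open FirstOrder

/-- A transition system with labels in `A`: a directed graph whose edges carry labels. -/
structure TransitionSystem (A : Type) where
  /-- the vertices -/
  V : Type
  /-- `E a v w`: there is an `a`-labelled edge from `v` to `w` -/
  E : A → V → V → Prop

namespace TransitionSystem

variable {A : Type}

/-- `G.Path l v w`: the word `l` labels a path of `G` from `v` to `w`. -/
def Path (G : TransitionSystem A) : List A → G.V → G.V → Prop
  | [], v, w => v = w
  | a :: l, v, w => ∃ u, G.E a v u ∧ G.Path l u w

/-- `G.Reach r v w`: some path of `G` from `v` to `w` is labelled by a word in the language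
described by the regular expression `r`. -/
def Reach (G : TransitionSystem A) (r : RegularExpression A) (v w : G.V) : Prop :=
  ∃ l ∈ r.matches', G.Path l v w

/-- The asynchronous product of two transition systems. The label sets of the components are made
disjoint; an edge acts in one component and leaves the other one fixed. -/
def asyncProduct {B : Type} (G : TransitionSystem A) (H : TransitionSystem B) :
    TransitionSystem (A ⊕ B) where
  V := G.V × H.V
  E
    | .inl a, v, w => G.E a v.1 w.1 ∧ v.2 = w.2
    | .inr b, v, w => H.E b v.2 w.2 ∧ v.1 = w.1

end TransitionSystem

/-- The non-logical symbols of FO(Reg) over the labels `A`, all of them binary relation symbols: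
`E_a` for `a` in `A`, and `Reach_r` for every regular expression `r` over `A`. -/
inductive Rel (A : Type) : ℕ → Type
  | edge (a : A) : Rel A 2
  | reach (r : RegularExpression A) : Rel A 2

/-- FO(Reg) is first-order logic with equality over these symbols. -/
abbrev lang (A : Type) : Language where
  Functions := fun _ => Empty
  Relations := Rel A

namespace TransitionSystem

variable {A : Type}

/-- A transition system as a structure for FO(Reg). -/
abbrev toStructure (G : TransitionSystem A) : (lang A).Structure G.V where
  funMap := fun f => nomatch f
  RelMap := fun R x =>
    match R, x with
    | .edge a, x => G.E a (x 0) (x 1)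
    | .reach r, x => G.Reach r (x 0) (x 1)

/-- `G.Models φ`: the FO(Reg)-sentence `φ` is true in `G`. -/
def Models (G : TransitionSystem A) (φ : (lang A).Sentence) : Prop :=
  letI := G.toStructure
  G.V ⊨ φ

end TransitionSystem

section Goedel

variable {A : Type} [Encodable A]

/-- Gödel numbers of regular expressions. -/
def codeRegex : RegularExpression A → ℕ
  | .zero => Nat.pair 0 0
  | .epsilon => Nat.pair 1 0
  | .char a => Nat.pair 2 (Encodable.encode a)
  | .plus r s => Nat.pair 3 (Nat.pair (codeRegex r) (codeRegex s))
  | .comp r s => Nat.pair 4 (Nat.pair (codeRegex r) (codeRegex s))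
  | .star r => Nat.pair 5 (codeRegex r)

/-- Terms are variables; the code of a variable is its index. -/
def codeTerm {n : ℕ} : (lang A).Term (Empty ⊕ Fin n) → ℕ
  | .var (.inr i) => i

/-- Gödel numbers of FO(Reg)-formulas whose free variables are among `n` given ones; every
quantifier binds the variable of the next free index. -/
def codeFormula : {n : ℕ} → (lang A).BoundedFormula Empty n → ℕ
  | _, .falsum => Nat.pair 0 0
  | _, .equal s t => Nat.pair 1 (Nat.pair (codeTerm s) (codeTerm t))
  | _, .rel (.edge a) ts =>
      Nat.pair 2 (Nat.pair (Encodable.encode a) (Nat.pair (codeTerm (ts 0)) (codeTerm (ts 1))))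
  | _, .rel (.reach r) ts =>
      Nat.pair 3 (Nat.pair (codeRegex r) (Nat.pair (codeTerm (ts 0)) (codeTerm (ts 1))))
  | _, .imp φ ψ => Nat.pair 4 (Nat.pair (codeFormula φ) (codeFormula ψ))
  | _, .all φ => Nat.pair 5 (codeFormula φ)

/-- The FO(Reg)-theory of `G` is decidable: some algorithm, given (the Gödel number of) an
FO(Reg)-sentence, tells whether the sentence is true in `G`. The label set is finite, so the choice
of the numbering of the labels does not matter. -/
def TransitionSystem.HasDecidableTheory [Finite A] (G : TransitionSystem A) : Prop :=
  ∃ f : ℕ → Bool, Computable f ∧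
    ∀ φ : (lang A).Sentence, f (codeFormula φ) = true ↔ G.Models φ

end Goedel

/-- A pushdown automaton with input alphabet `A`, without accepting states, which play no role for
its graph. A transition `(q, a, g, h, p)` leads from state `q` to state `p`, is labelled by the
input letter `a`, takes `g` from the top of the stack and then puts `h` on it; here `none` stands
for the empty word. -/
structure PDA (A : Type) where
  /-- the states -/
  Q : Type
  /-- the stack alphabet -/
  Γ : Type
  finQ : Finite Q
  finΓ : Finite Γ
  /-- the initial state -/
  init : Q
  /-- the transition relation -/
  Δ : Set (Q × A × Option Γ × Option Γ × Q)

namespace PDA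

variable {A : Type}

/-- A configuration: the state and the content of the stack, topmost letter first. -/
abbrev Config (P : PDA A) : Type := P.Q × List P.Γ

/-- `P.Step a c d`: an `a`-labelled transition leads from `c` to `d`. -/
def Step (P : PDA A) (a : A) (c d : P.Config) : Prop :=
  ∃ (g h : Option P.Γ) (u : List P.Γ),
    (c.1, a, g, h, d.1) ∈ P.Δ ∧ c.2 = g.toList ++ u ∧ d.2 = h.toList ++ u

/-- `c` can be reached from the initial configuration (initial state, empty stack). -/
def Reachable (P : PDA A) (c : P.Config) : Prop :=
  Relation.ReflTransGen (fun c d => ∃ a, P.Step a c d) (P.init, []) c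

/-- The pushdown graph generated by `P`: its vertices are the reachable configurations, its edges
the labelled transitions between them. -/
def graph (P : PDA A) : TransitionSystem A where
  V := {c : P.Config // P.Reachable c}
  E := fun a c d => P.Step a c.1 d.1

end PDA

end FOReg

namespace FOReg

open FirstOrder

/-! ### Reachability by regular expressions, and isomorphisms -/

namespace TransitionSystem

variable {A B : Type}

/-! Both pushdown graphs are the counter: the natural numbers with increment, decrement and a loop
at zero that serves as a zero test.

Undecidability of the product. On two counters a regular expression acts as the finite control of a
two-counter machine. A store of registers `s` is kept in the first counter as the product of the
powers `p_i ^ s i`, with the second counter as scratch space; changing or testing a register becomes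
multiplication, division or a divisibility test. `Program` is an intermediate language, regular
expressions over register instructions: `computes_of_partrec'` shows that it computes all partial
recursive functions, and `Program.grid_reach_toRegex` translates it to the two counters. Zero tests
at the beginning pin down the start vertex, so "no `x`, `y` satisfy `Reach_r(x, y)`" says that a
given function diverges on `n`, where the code of `r` is computable from `n`. A decision procedure
would solve the halting problem.

Decidability for the counter. Replace `r` by a finite automaton. The state changes it can make on
loops that stay below level `n` form a relation determined by the one for `n - 1`. There are
finitely many relations, so this sequence is eventually periodic; the same holds for climbs by `d`
levels. Hence `Reach_r(x, y)` depends only on `x`, `y` and `y - x`, each up to congruence beyond a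
threshold (`counterReach_congr`). A back-and-forth argument (`exists_similar`, `holds_congr`)
extends this to all formulas and confines quantifiers to a finite range (`holds_all_iff_bounded`);
paths can be confined to a bounded height (`counterReach_iff_bounded`). All bounds are computable
from the Gödel number, so truth becomes a finite check, organised as a primitive recursion on tasks
(`exists_primrec_eval`, `val_formula`). -/

theorem path_append (G : TransitionSystem A) (l m : List A) (v w : G.V) :
    G.Path (l ++ m) v w ↔ ∃ u, G.Path l v u ∧ G.Path m u w := by
  induction l generalizing v with
  | nil => simp [Path]
  | cons a l ih =>
    simp only [List.cons_append, Path, ih]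
    constructor
    · rintro ⟨u, h, x, h1, h2⟩
      exact ⟨x, ⟨u, h, h1⟩, h2⟩
    · rintro ⟨x, ⟨u, h, h1⟩, h2⟩
      exact ⟨u, h, x, h1, h2⟩

theorem reach_zero (G : TransitionSystem A) (v w : G.V) : ¬ G.Reach .zero v w := by
  rintro ⟨l, h, -⟩
  exact h

theorem reach_epsilon (G : TransitionSystem A) (v w : G.V) : G.Reach .epsilon v w ↔ v = w := by
  constructor
  · rintro ⟨l, h, hp⟩
    obtain rfl : l = [] := h
    exact hp
  · rintro h
    exact ⟨[], rfl, h⟩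

theorem reach_char (G : TransitionSystem A) (a : A) (v w : G.V) :
    G.Reach (.char a) v w ↔ G.E a v w := by
  constructor
  · rintro ⟨l, h, hp⟩
    obtain rfl : l = [a] := h
    obtain ⟨u, h, rfl⟩ := hp
    exact h
  · rintro h
    exact ⟨[a], rfl, w, h, rfl⟩

theorem reach_plus (G : TransitionSystem A) (r s : RegularExpression A) (v w : G.V) :
    G.Reach (.plus r s) v w ↔ G.Reach r v w ∨ G.Reach s v w := by
  constructor
  · rintro ⟨l, h | h, hp⟩
    · exact .inl ⟨l, h, hp⟩
    · exact .inr ⟨l, h, hp⟩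
  · rintro (⟨l, h, hp⟩ | ⟨l, h, hp⟩)
    · exact ⟨l, .inl h, hp⟩
    · exact ⟨l, .inr h, hp⟩

theorem reach_comp (G : TransitionSystem A) (r s : RegularExpression A) (v w : G.V) :
    G.Reach (.comp r s) v w ↔ ∃ u, G.Reach r v u ∧ G.Reach s u w := by
  constructor
  · rintro ⟨l, h, hp⟩
    obtain ⟨l₁, h₁, l₂, h₂, rfl⟩ := Language.mem_mul.1 h
    obtain ⟨u, p₁, p₂⟩ := (G.path_append _ _ _ _).1 hp
    exact ⟨u, ⟨l₁, h₁, p₁⟩, ⟨l₂, h₂, p₂⟩⟩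
  · rintro ⟨u, ⟨l₁, h₁, p₁⟩, ⟨l₂, h₂, p₂⟩⟩
    exact ⟨l₁ ++ l₂, Language.mem_mul.2 ⟨_, h₁, _, h₂, rfl⟩,
      (G.path_append _ _ _ _).2 ⟨u, p₁, p₂⟩⟩

theorem reach_star (G : TransitionSystem A) (r : RegularExpression A) (v w : G.V) :
    G.Reach (.star r) v w ↔ Relation.ReflTransGen (G.Reach r) v w := by
  constructor
  · rintro ⟨l, h, hp⟩
    obtain ⟨L, rfl, hL⟩ := Language.mem_kstar.1 h
    clear h
    induction L generalizing v with
    | nil => obtain rfl : v = w := hp; exact .refl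
    | cons l L ih =>
      obtain ⟨u, p₁, p₂⟩ := (G.path_append _ _ _ _).1 hp
      exact .head ⟨l, hL _ (by simp), p₁⟩ (ih u (fun y hy => hL y (by simp [hy])) p₂)
  · intro h
    induction h using Relation.ReflTransGen.head_induction_on with
    | refl => exact ⟨[], Language.nil_mem_kstar _, rfl⟩
    | head h _ ih =>
      obtain ⟨l, hl, p⟩ := h
      obtain ⟨m, hm, q⟩ := ih
      obtain ⟨L, rfl, hL⟩ := Language.mem_kstar.1 hm
      refine ⟨l ++ L.flatten, Language.mem_kstar.2 ⟨l :: L, by simp, ?_⟩,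
        (G.path_append _ _ _ _).2 ⟨_, p, q⟩⟩
      intro y hy
      rcases List.mem_cons.1 hy with rfl | hy
      exacts [hl, hL y hy]

/-- An isomorphism of transition systems. -/
structure Iso (G H : TransitionSystem A) where
  toEquiv : G.V ≃ H.V
  map_edge : ∀ a v w, H.E a (toEquiv v) (toEquiv w) ↔ G.E a v w

theorem Iso.map_path {G H : TransitionSystem A} (e : Iso G H) (l : List A) (v w : G.V) :
    H.Path l (e.toEquiv v) (e.toEquiv w) ↔ G.Path l v w := by
  induction l generalizing v with
  | nil => simp [Path]
  | cons a l ih =>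
    simp only [Path]
    rw [← e.toEquiv.exists_congr_right]
    simp only [e.map_edge, ih]

theorem Iso.map_reach {G H : TransitionSystem A} (e : Iso G H) (r : RegularExpression A)
    (v w : G.V) : H.Reach r (e.toEquiv v) (e.toEquiv w) ↔ G.Reach r v w := by
  simp only [Reach, e.map_path]

theorem Iso.models {G H : TransitionSystem A} (e : Iso G H) (φ : (lang A).Sentence) :
    G.Models φ ↔ H.Models φ := by
  let := G.toStructure
  let := H.toStructure
  let g : G.V ≃[lang A] H.V :=
    { toEquiv := e.toEquiv
      map_fun' := fun f => nomatch f
      map_rel' := by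
        intro n R x
        cases R with
        | edge a => exact e.map_edge a _ _
        | reach r => exact e.map_reach r _ _ }
  exact Language.StrongHomClass.realize_sentence g φ

theorem Iso.hasDecidableTheory [Finite A] [Encodable A] {G H : TransitionSystem A} (e : Iso G H)
    (h : H.HasDecidableTheory) : G.HasDecidableTheory := by
  obtain ⟨f, hf, hφ⟩ := h
  exact ⟨f, hf, fun φ => (hφ φ).trans (e.models φ).symm⟩

/-- Asynchronous products of isomorphic systems are isomorphic. -/
def Iso.asyncProduct {G G' : TransitionSystem A} {H H' : TransitionSystem B} (e : Iso G G')
    (f : Iso H H') : Iso (G.asyncProduct H) (G'.asyncProduct H') where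
  toEquiv := Equiv.prodCongr e.toEquiv f.toEquiv
  map_edge a v w := by
    cases a with
    | inl a => exact and_congr (e.map_edge a _ _) f.toEquiv.injective.eq_iff
    | inr a => exact and_congr (f.map_edge a _ _) e.toEquiv.injective.eq_iff

/-- The inverse isomorphism. -/
def Iso.symm {G H : TransitionSystem A} (e : Iso G H) : Iso H G where
  toEquiv := e.toEquiv.symm
  map_edge a v w := by
    rw [← e.map_edge]
    simp

/-- The truth of a universally quantified pair of variables not being connected. -/
theorem models_all_all_not_reach (G : TransitionSystem A) (r : RegularExpression A) :
    G.Models (.all (.all (.imp (.rel (.reach r) ![.var (.inr 0), .var (.inr 1)]) .falsum))) ↔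
      ∀ v w, ¬ G.Reach r v w := by
  let := G.toStructure
  unfold Models Language.Sentence.Realize Language.Formula.Realize
  simp only [Language.BoundedFormula.Realize]
  rfl

end TransitionSystem

/-! ### The counter as a pushdown graph -/

/-- The counter: natural numbers with edges for increment, decrement, and a loop at zero. -/
def counter : TransitionSystem (Fin 3) where
  V := ℕ
  E a v w := match a with
    | 0 => w = v + 1
    | 1 => v = w + 1
    | 2 => v = 0 ∧ w = 0

/-- The transitions of `counterPDA`. -/
def counterTransitions : Set (Bool × Fin 3 × Option Bool × Option Bool × Bool) :=
  {(false, 0, none, some true, true), (true, 0, none, some false, true),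
    (true, 1, some false, none, true), (true, 1, some true, none, false),
    (false, 2, none, none, false)}

/-- A pushdown automaton that generates the counter. The state tells whether the counter is
nonzero, the stack letter `true` marks the bottom. -/
def counterPDA : PDA (Fin 3) where
  Q := Bool
  Γ := Bool
  finQ := inferInstance
  finΓ := inferInstance
  init := false
  Δ := counterTransitions

/-- The configuration that represents a number. -/
def counterConfig : ℕ → Bool × List Bool
  | 0 => (false, [])
  | n + 1 => (true, List.replicate n false ++ [true])

theorem counterConfig_injective : Function.Injective counterConfig := by
  rintro (_ | n) (_ | m) h
  · rfl
  · simp [counterConfig] at h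
  · simp [counterConfig] at h
  · have := congrArg (fun c => c.2.length) h
    simpa [counterConfig] using this

theorem counterPDA_step_iff (a : Fin 3) (c d : Bool × List Bool) :
    counterPDA.Step a c d ↔ ∃ (g h : Option Bool) (u : List Bool),
      (c.1, a, g, h, d.1) ∈ counterTransitions ∧ c.2 = g.toList ++ u ∧ d.2 = h.toList ++ u :=
  Iff.rfl

/-- The bottom letter makes zero visible: popping it is the only way back to the state `false`,
which alone carries the loop. Since successors are again of the form `counterConfig m`, the
reachable configurations are exactly these. -/
theorem counterPDA_step (a : Fin 3) (n : ℕ) (d : Bool × List Bool) :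
    counterPDA.Step a (counterConfig n) d ↔ ∃ m, d = counterConfig m ∧ counter.E a n m := by
  obtain ⟨q, l⟩ := d
  rw [counterPDA_step_iff]
  constructor
  · rintro ⟨g, h, u, hΔ, h1, h2⟩
    simp only [counterTransitions, Set.mem_insert_iff, Set.mem_singleton_iff, Prod.mk.injEq] at hΔ
    rcases hΔ with ⟨hq, rfl, rfl, rfl, rfl⟩ | ⟨hq, rfl, rfl, rfl, rfl⟩ | ⟨hq, rfl, rfl, rfl, rfl⟩ |
      ⟨hq, rfl, rfl, rfl, rfl⟩ | ⟨hq, rfl, rfl, rfl, rfl⟩ <;>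
    rcases n with _ | n <;> simp [counterConfig] at hq h1 h2
    · subst h1 h2
      exact ⟨1, by simp [counterConfig], rfl⟩
    · subst h1 h2
      exact ⟨n + 2, by simp [counterConfig, List.replicate_succ], rfl⟩
    · rcases n with _ | n
      · simp at h1
      · simp only [List.replicate_succ, List.cons_append, List.cons.injEq, true_and] at h1
        subst h1 h2
        exact ⟨n + 1, by simp [counterConfig], rfl⟩
    · rcases n with _ | n
      · simp at h1
        subst h1 h2
        exact ⟨0, by simp [counterConfig], rfl⟩
      · simp [List.replicate_succ] at h1
    · subst h1 h2
      exact ⟨0, by simp [counterConfig], rfl, rfl⟩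
  · rintro ⟨m, hm, h⟩
    rw [hm]
    fin_cases a
    · obtain rfl : m = n + 1 := h
      rcases n with _ | n
      · exact ⟨none, some true, [], by simp [counterTransitions, counterConfig], rfl, rfl⟩
      · exact ⟨none, some false, List.replicate n false ++ [true],
          by simp [counterTransitions, counterConfig], rfl,
          by simp [counterConfig, List.replicate_succ]⟩
    · obtain rfl : n = m + 1 := h
      rcases m with _ | m
      · exact ⟨some true, none, [], by simp [counterTransitions, counterConfig], rfl, rfl⟩
      · exact ⟨some false, none, List.replicate m false ++ [true],
          by simp [counterTransitions, counterConfig],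
          by simp [counterConfig, List.replicate_succ], rfl⟩
    · obtain ⟨rfl, rfl⟩ : n = 0 ∧ m = 0 := h
      exact ⟨none, none, [], by simp [counterTransitions, counterConfig], rfl, rfl⟩

theorem counterPDA_reachable (n : ℕ) : counterPDA.Reachable (counterConfig n) := by
  induction n with
  | zero => exact .refl
  | succ n ih => exact .tail ih ⟨0, (counterPDA_step 0 n _).2 ⟨n + 1, rfl, rfl⟩⟩

theorem exists_of_counterPDA_reachable {c : counterPDA.Config} (h : counterPDA.Reachable c) :
    ∃ n, counterConfig n = c := by
  induction h with
  | refl => exact ⟨0, rfl⟩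
  | tail _ h ih =>
    obtain ⟨n, rfl⟩ := ih
    obtain ⟨a, h⟩ := h
    obtain ⟨m, rfl, -⟩ := (counterPDA_step a n _).1 h
    exact ⟨m, rfl⟩

/-- The pushdown graph of `counterPDA` is the counter. -/
noncomputable def counterIso : TransitionSystem.Iso counter counterPDA.graph where
  toEquiv := Equiv.ofBijective (fun n => ⟨counterConfig n, counterPDA_reachable n⟩)
    ⟨fun n m h => counterConfig_injective (congrArg Subtype.val h), fun c => by
      obtain ⟨n, hn⟩ := exists_of_counterPDA_reachable c.2
      exact ⟨n, Subtype.ext hn⟩⟩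
  map_edge a n m := by
    refine (counterPDA_step a n (counterConfig m)).trans ⟨?_, fun h => ⟨m, rfl, h⟩⟩
    rintro ⟨k, hk, h⟩
    rwa [counterConfig_injective hk]

end FOReg
-- Register programs compute all partial recursive functions
namespace FOReg

open Finsupp

/-- Programs that operate on a store of infinitely many registers. -/
inductive Program
  | skip
  | inc (i : ℕ)
  | dec (i : ℕ)
  | zero (i : ℕ)
  | comp (P Q : Program)
  | plus (P Q : Program)
  | star (P : Program)

namespace Program

/-- `P.Run s t`: the program `P` can transform the store `s` into `t`. -/
def Run : Program → (ℕ →₀ ℕ) → (ℕ →₀ ℕ) → Prop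
  | skip, s, t => t = s
  | inc i, s, t => t = s + single i 1
  | dec i, s, t => s = t + single i 1
  | zero i, s, t => s i = 0 ∧ t = s
  | comp P Q, s, t => ∃ u, P.Run s u ∧ Q.Run u t
  | plus P Q, s, t => P.Run s t ∨ Q.Run s t
  | star P, s, t => Relation.ReflTransGen P.Run s t

theorem run_dec {i : ℕ} {s u t : ℕ →₀ ℕ} (h : s = u + single i 1) :
    (dec i).Run s t ↔ t = u := by
  subst h
  simp only [Run, add_left_inj]
  exact eq_comm

theorem not_run_dec {i : ℕ} {s t : ℕ →₀ ℕ} (h : s i = 0) : ¬ (dec i).Run s t := by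
  intro hr
  have := DFunLike.congr_fun (show s = t + single i 1 from hr) i
  simp [h] at this

/-- Most programs below have a single possible result on the stores considered; describing it by `t
= u` lets sequences be evaluated by rewriting. -/
theorem run_comp_of_iff {P Q : Program} {s u t : ℕ →₀ ℕ} (h : ∀ t, P.Run s t ↔ t = u) :
    (comp P Q).Run s t ↔ Q.Run u t := by
  simp [Run, h]

/-- The loop follows one trajectory `st` and may stop anywhere before the first failure of `ok`; a
test placed after the loop selects the right moment. -/
theorem run_star_of_iff {P : Program} (st : ℕ → ℕ →₀ ℕ) (ok : ℕ → Prop)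
    (h : ∀ i t, P.Run (st i) t ↔ ok i ∧ t = st (i + 1)) (t : ℕ →₀ ℕ) :
    (star P).Run (st 0) t ↔ ∃ i, t = st i ∧ ∀ j < i, ok j := by
  constructor
  · intro hr
    change Relation.ReflTransGen P.Run (st 0) t at hr
    induction hr with
    | refl => exact ⟨0, rfl, by simp⟩
    | tail _ hr ih =>
      obtain ⟨i, rfl, hi⟩ := ih
      obtain ⟨h1, rfl⟩ := (h i _).1 hr
      refine ⟨i + 1, rfl, fun j hj => ?_⟩
      rcases Nat.lt_succ_iff_lt_or_eq.1 hj with hj | rfl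
      exacts [hi j hj, h1]
  · rintro ⟨i, rfl, hi⟩
    change Relation.ReflTransGen P.Run (st 0) (st i)
    induction i with
    | zero => exact .refl
    | succ i ih =>
      exact .tail (ih fun j hj => hi j (by omega)) ((h i _).2 ⟨hi i (by omega), rfl⟩)

/-- Repeat `P` until the register `c` is zero. -/
def untilZero (c : ℕ) (P : Program) : Program := comp (star (comp (dec c) P)) (zero c)

theorem run_untilZero {P : Program} {c : ℕ} (st : ℕ → ℕ →₀ ℕ) (n : ℕ)
    (hc : ∀ i ≤ n, st i c = n - i)
    (h : ∀ i < n, ∀ t, (comp (dec c) P).Run (st i) t ↔ t = st (i + 1)) (t : ℕ →₀ ℕ) :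
    (untilZero c P).Run (st 0) t ↔ t = st n := by
  -- The trajectory is frozen from `n` on, where register `c` is empty and `dec c` blocks.
  have key : ∀ t, (star (comp (dec c) P)).Run (st 0) t ↔ ∃ i, t = st (min i n) ∧ ∀ j < i, j < n := by
    intro t
    refine (run_star_of_iff (fun i => st (min i n)) (fun i => i < n) ?_ t)
    intro i t
    rcases lt_or_ge i n with hi | hi
    · simp only [min_eq_left hi.le, min_eq_left (Nat.succ_le_of_lt hi), hi, true_and]
      exact h i hi t
    · simp only [min_eq_right hi, not_lt.2 hi, false_and, iff_false]
      rintro ⟨u, hu, -⟩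
      exact not_run_dec (by rw [hc n le_rfl, Nat.sub_self]) hu
  constructor
  · rintro ⟨u, hu, h0, rfl⟩
    obtain ⟨i, rfl, -⟩ := (key _).1 hu
    rw [hc _ (min_le_right _ _)] at h0
    congr 1
    omega
  · rintro rfl
    exact ⟨_, (key _).2 ⟨n, rfl, fun j hj => hj⟩, by simp [hc], by simp⟩

/-- Set the register `i` to zero. -/
def clear (i : ℕ) : Program := untilZero i skip

/-- Writing the store as `s + single i m` with `s i = 0` displays the content `m`, so that the loop
runs through `s + single i (m - k)`. -/
theorem run_clear {i : ℕ} {s : ℕ →₀ ℕ} (hs : s i = 0) (m : ℕ) (t : ℕ →₀ ℕ) :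
    (clear i).Run (s + single i m) t ↔ t = s := by
  refine (run_untilZero (fun k => s + single i (m - k)) m (by simp [hs]) ?_ t).trans (by simp)
  intro k hk t
  rw [run_comp_of_iff fun _ => run_dec (u := s + single i (m - (k + 1))) ?_]
  · rfl
  · rw [add_assoc, ← single_add]
    congr 2
    omega

/-- Add the content of the register `i` to the register `j` and set `i` to zero. -/
def move (i j : ℕ) : Program := untilZero i (inc j)

theorem run_move {i j : ℕ} (hij : i ≠ j) {s : ℕ →₀ ℕ} (hs : s i = 0) (m : ℕ) (t : ℕ →₀ ℕ) :
    (move i j).Run (s + single i m) t ↔ t = s + single j m := by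
  have := run_untilZero (P := inc j) (c := i) (fun k => s + single i (m - k) + single j k) m
    (by simp [hs, hij]) ?_ t
  · simpa [move] using this
  intro k hk t
  rw [run_comp_of_iff fun _ => run_dec (u := s + single i (m - (k + 1)) + single j k) ?_]
  · simp [Run, single_add, add_assoc]
  · have : m - k = m - (k + 1) + 1 := by omega
    rw [this, single_add]
    abel

/-- Add the content of the register `i` to the register `j`; the register `c` is scratch. -/
def copy (i j c : ℕ) : Program := comp (untilZero i (comp (inc j) (inc c))) (move c i)

theorem run_copy {i j c : ℕ} (hij : i ≠ j) (hic : i ≠ c) (hjc : j ≠ c) {s : ℕ →₀ ℕ}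
    (hs : s c = 0) (t : ℕ →₀ ℕ) : (copy i j c).Run s t ↔ t = s + single j (s i) := by
  obtain ⟨u, m, hu, rfl⟩ : ∃ u m, u i = 0 ∧ s = u + single i m :=
    ⟨s.erase i, s i, by simp, (erase_add_single i s).symm⟩
  have huc : u c = 0 := by simpa [hic] using hs
  have key : ∀ t, (untilZero i (comp (inc j) (inc c))).Run (u + single i m) t ↔
      t = u + single j m + single c m := by
    intro t
    have := run_untilZero (P := comp (inc j) (inc c)) (c := i)
      (fun k => u + single i (m - k) + single j k + single c k) m
      (by simp [hu, hij, hic]) ?_ t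
    · simpa using this
    intro k hk t
    rw [run_comp_of_iff fun _ =>
      run_dec (u := u + single i (m - (k + 1)) + single j k + single c k) ?_]
    · simp only [Run, exists_eq_left, single_add]
      rw [iff_iff_eq]
      congr 1
      abel
    · have : m - k = m - (k + 1) + 1 := by omega
      rw [this, single_add]
      abel
  rw [copy, run_comp_of_iff key, run_move hic.symm (by simp [huc, hjc])]
  rw [iff_iff_eq]
  congr 1
  simp [hu]
  abel

end Program

open Program List

/-- The partial function `f` can be computed by a program, for any choice of input registers and of
a different output register, with the registers from `b` on as scratch space. -/
def Computes {n : ℕ} (f : List.Vector ℕ n →. ℕ) : Prop :=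
  ∀ (ins : Fin n → ℕ) (out b : ℕ), (∀ i, ins i < b) → out < b → (∀ i, ins i ≠ out) →
    ∃ P : Program, ∀ s : ℕ →₀ ℕ, (∀ j, b ≤ j → s j = 0) → s out = 0 → ∀ t, P.Run s t ↔
      ∃ y ∈ f (List.Vector.ofFn fun i => s (ins i)), t = s + single out y

theorem computes_zero : Computes (n := 0) (fun _ => Part.some 0) := by
  intro ins out b _ _ _
  exact ⟨skip, fun s _ _ t => by simp [Run]⟩

theorem computes_get {n : ℕ} (i : Fin n) : Computes (n := n) (fun v => Part.some (v.get i)) := by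
  intro ins out b hins hout hne
  refine ⟨copy (ins i) out b, fun s hs _ t => ?_⟩
  rw [run_copy (hne i) (hins i).ne hout.ne (hs b le_rfl)]
  simp

theorem computes_succ : Computes (n := 1) (fun v => Part.some v.head.succ) := by
  intro ins out b hins hout hne
  refine ⟨comp (copy (ins 0) out b) (inc out), fun s hs _ t => ?_⟩
  rw [run_comp_of_iff fun _ => run_copy (hne 0) (hins 0).ne hout.ne (hs b le_rfl) _]
  simp [Run, add_assoc]

/-- The functions are evaluated one after another. The `i`-th result goes to register `b + i` and
the scratch space starts just above, so neither inputs nor earlier results are disturbed. -/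
theorem exists_program_forall {m n : ℕ} (g : Fin n → List.Vector ℕ m →. ℕ)
    (hg : ∀ i, Computes (g i)) (ins : Fin m → ℕ) (b : ℕ) (hins : ∀ i, ins i < b) :
    ∃ P : Program, ∀ s : ℕ →₀ ℕ, (∀ j, b ≤ j → s j = 0) → ∀ t, P.Run s t ↔
      ∃ y : Fin n → ℕ, (∀ i, y i ∈ g i (List.Vector.ofFn fun i => s (ins i))) ∧
        t = s + ∑ i : Fin n, single (b + i) (y i) := by
  induction n with
  | zero => exact ⟨skip, fun s _ t => by simp [Run]⟩
  | succ n ih =>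
    obtain ⟨P, hP⟩ := ih (fun i => g i.castSucc) (fun i => hg _)
    obtain ⟨Q, hQ⟩ := hg (Fin.last n) ins (b + n) (b + n + 1) (fun i => by have := hins i; omega)
      (by omega) (fun i => by have := hins i; omega)
    refine ⟨comp P Q, fun s hs t => ?_⟩
    have hsum : ∀ (y : Fin n → ℕ) j, j < b ∨ b + n ≤ j →
        (∑ i : Fin n, single (b + i.1) (y i)) j = 0 := by
      intro y j hj
      rw [finsetSum_apply]
      refine Finset.sum_eq_zero fun i _ => single_eq_of_ne ?_
      have := i.2
      omega
    have key : ∀ y : Fin n → ℕ, Q.Run (s + ∑ i : Fin n, single (b + i.1) (y i)) t ↔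
        ∃ z ∈ g (Fin.last n) (List.Vector.ofFn fun i => s (ins i)),
          t = s + ∑ i : Fin n, single (b + i.1) (y i) + single (b + n) z := by
      intro y
      rw [hQ _ (fun j hj => by rw [Finsupp.add_apply, hs j (by omega), hsum y j (by omega)])
        (by rw [Finsupp.add_apply, hs (b + n) (by omega), hsum y (b + n) (.inr le_rfl)])]
      simp only [Finsupp.add_apply, hsum y _ (Or.inl (hins _)), add_zero]
    constructor
    · rintro ⟨u, hu, ht⟩
      obtain ⟨y, hy, rfl⟩ := (hP s hs u).1 hu
      obtain ⟨z, hz, rfl⟩ := (key y).1 ht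
      refine ⟨Fin.snoc y z, fun i => ?_, ?_⟩
      · refine Fin.lastCases ?_ (fun i => ?_) i
        · simpa using hz
        · simpa using hy i
      · simp [Fin.sum_univ_castSucc, add_assoc]
    · rintro ⟨y, hy, rfl⟩
      refine ⟨_, (hP s hs _).2 ⟨fun i => y i.castSucc, fun i => hy _, rfl⟩, ?_⟩
      refine (key _).2 ⟨_, hy (Fin.last n), ?_⟩
      simp [Fin.sum_univ_castSucc, add_assoc]

/-- `Computes` prescribes the whole final store, so intermediate results must be erased. -/
theorem exists_program_clear (b n : ℕ) :
    ∃ P : Program, ∀ s : ℕ →₀ ℕ, (∀ j, b ≤ j → s j = 0) → ∀ (y : Fin n → ℕ) t,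
      P.Run (s + ∑ i : Fin n, single (b + i) (y i)) t ↔ t = s := by
  induction n generalizing b with
  | zero => exact ⟨skip, fun s _ y t => by simp [Run]⟩
  | succ n ih =>
    obtain ⟨P, hP⟩ := ih (b + 1)
    refine ⟨comp P (clear b), fun s hs y t => ?_⟩
    have h1 : s + ∑ i : Fin (n + 1), single (b + i.1) (y i) =
        (s + single b (y 0)) + ∑ i : Fin n, single (b + 1 + i.1) (y i.succ) := by
      rw [Fin.sum_univ_succ, ← add_assoc]
      simp [add_assoc, add_comm 1]
    rw [h1, run_comp_of_iff fun t => hP (s + single b (y 0)) (fun j hj => ?_) _ t,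
      run_clear (hs b le_rfl)]
    rw [Finsupp.add_apply, hs j (by omega), single_eq_of_ne (by omega)]; rfl

/-- The composite is given by its graph `hF`, which covers composition of total functions and, in
the `Part` monad, of partial ones alike. -/
theorem Computes.comp {m n : ℕ} {f : List.Vector ℕ n →. ℕ} {g : Fin n → List.Vector ℕ m →. ℕ}
    (hf : Computes f) (hg : ∀ i, Computes (g i)) {F : List.Vector ℕ m →. ℕ}
    (hF : ∀ v z, z ∈ F v ↔ ∃ y : Fin n → ℕ, (∀ i, y i ∈ g i v) ∧ z ∈ f (List.Vector.ofFn y)) :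
    Computes F := by
  intro ins out b hins hout hne
  obtain ⟨P, hP⟩ := exists_program_forall g hg ins b hins
  obtain ⟨Q, hQ⟩ := hf (fun i => b + i) out (b + n) (fun i => by simp) (by omega)
    (fun i => by omega)
  obtain ⟨R, hR⟩ := exists_program_clear b n
  refine ⟨.comp P (.comp Q R), fun s hs hso t => ?_⟩
  have hsum : ∀ (y : Fin n → ℕ) j, j < b ∨ b + n ≤ j →
      (∑ i : Fin n, single (b + i.1) (y i)) j = 0 := by
    intro y j hj
    rw [finsetSum_apply]
    refine Finset.sum_eq_zero fun i _ => single_eq_of_ne ?_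
    have := i.2
    omega
  have hval : ∀ (y : Fin n → ℕ) (k : Fin n),
      (s + ∑ i : Fin n, single (b + i.1) (y i)) (b + k) = y k := by
    intro y k
    rw [Finsupp.add_apply, hs _ (by omega), finsetSum_apply, zero_add,
      Finset.sum_eq_single k, single_eq_same]
    · intro i _ hi
      exact single_eq_of_ne (fun h => hi (Fin.ext (by omega)))
    · simp
  have key : ∀ y : Fin n → ℕ,
      (Program.comp Q R).Run (s + ∑ i : Fin n, single (b + i.1) (y i)) t ↔
        ∃ z ∈ f (List.Vector.ofFn y), t = s + single out z := by
    intro y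
    have hq := hQ (s + ∑ i : Fin n, single (b + i.1) (y i))
      (fun j hj => by rw [Finsupp.add_apply, hs j (by omega), hsum y j (by omega)])
      (by rw [Finsupp.add_apply, hso, hsum y out (.inl hout)])
    simp only [hval] at hq
    have hr : ∀ z, R.Run (s + ∑ i : Fin n, single (b + i.1) (y i) + single out z) t ↔
        t = s + single out z := by
      intro z
      rw [add_right_comm]
      refine hR _ (fun j hj => ?_) y t
      rw [Finsupp.add_apply, hs j hj, single_eq_of_ne (by omega)]; rfl
    constructor
    · rintro ⟨u, hu, ht⟩
      obtain ⟨z, hz, rfl⟩ := (hq u).1 hu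
      exact ⟨z, hz, (hr z).1 ht⟩
    · rintro ⟨z, hz, h⟩
      exact ⟨_, (hq _).2 ⟨z, hz, rfl⟩, (hr z).2 h⟩
  constructor
  · rintro ⟨u, hu, ht⟩
    obtain ⟨y, hy, rfl⟩ := (hP s hs u).1 hu
    obtain ⟨z, hz, h⟩ := (key y).1 ht
    exact ⟨z, (hF _ _).2 ⟨y, hy, hz⟩, h⟩
  · rintro ⟨z, hz, h⟩
    obtain ⟨y, hy, hz⟩ := (hF _ _).1 hz
    exact ⟨_, (hP s hs _).2 ⟨y, hy, rfl⟩, (key y).2 ⟨z, hz, h⟩⟩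

theorem ofFn_eq_cons {n : ℕ} (w : Fin (n + 1) → ℕ) :
    List.Vector.ofFn w = w 0 ::ᵥ List.Vector.ofFn fun i => w i.succ := rfl

/-- The output register is itself the search variable, and `b` holds the value of `f` at it. Each
round starts with `dec b`, which requires a nonzero value; the final `zero b` passes only at a zero.
Together they select the first zero, and without one there is no run. -/
theorem Computes.rfind {n : ℕ} {f : List.Vector ℕ (n + 1) → ℕ}
    (hf : Computes fun v => Part.some (f v)) :
    Computes fun v => Nat.rfind fun k => Part.some (decide (f (k ::ᵥ v) = 0)) := by
  intro ins out b hins hout hne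
  obtain ⟨P, hP⟩ := hf (Fin.cons out ins) b (b + 1)
    (fun i => by
      refine Fin.cases ?_ (fun i => ?_) i
      · simp; omega
      · have := hins i; simp; omega)
    (by omega)
    (fun i => by
      refine Fin.cases ?_ (fun i => ?_) i
      · simp; omega
      · have := hins i; simp; omega)
  refine ⟨.comp P (.comp (star (.comp (dec b) (.comp (clear b) (.comp (inc out) P)))) (zero b)),
    fun s hs hso t => ?_⟩
  set v := List.Vector.ofFn fun i => s (ins i) with hv
  have hrun : ∀ k t, P.Run (s + single out k) t ↔
      t = s + single out k + single b (f (k ::ᵥ v)) := by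
    intro k t
    rw [hP (s + single out k)
      (fun j hj => by rw [Finsupp.add_apply, hs j (by omega), single_eq_of_ne (by omega)]; rfl)
      (by rw [Finsupp.add_apply, hs b le_rfl, single_eq_of_ne (by omega)]; rfl)]
    have : (List.Vector.ofFn fun i => (s + single out k) ((Fin.cons out ins : Fin (n + 1) → ℕ) i)) =
        k ::ᵥ v := by
      rw [ofFn_eq_cons, hv]
      congr 1
      · simp [hso]
      · congr 1
        funext i
        simp [hne i]
    rw [this]
    simp
  have hP0 := hrun 0
  simp only [single_zero, add_zero] at hP0
  rw [run_comp_of_iff hP0]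
  have hstar := run_star_of_iff
    (P := .comp (dec b) (.comp (clear b) (.comp (inc out) P)))
    (fun k => s + single out k + single b (f (k ::ᵥ v))) (fun k => f (k ::ᵥ v) ≠ 0) (by
      intro k t
      rcases Nat.eq_zero_or_pos (f (k ::ᵥ v)) with h0 | h0
      · simp only [h0, ne_eq, not_true_eq_false, false_and, iff_false]
        rintro ⟨u, hu, -⟩
        refine not_run_dec ?_ hu
        simp [hs b le_rfl, hout.ne]
      · obtain ⟨m, hm⟩ := Nat.exists_eq_succ_of_ne_zero h0.ne'
        simp only [hm, ne_eq, Nat.succ_ne_zero, not_false_eq_true, true_and]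
        rw [run_comp_of_iff fun _ => run_dec (u := s + single out k + single b m) ?_,
          run_comp_of_iff fun _ => run_clear (by simp [hs b le_rfl, hout.ne]) m _,
          run_comp_of_iff (u := s + single out (k + 1)) ?_, hrun]
        · intro t
          simp [Run, single_add, add_assoc]
        · rw [add_assoc _ (single b m), ← single_add])
  simp only [single_zero, add_zero] at hstar
  constructor
  · rintro ⟨u, hu, h0, rfl⟩
    obtain ⟨k, rfl, hk⟩ := (hstar _).1 hu
    have h0 : f (k ::ᵥ v) = 0 := by simpa [hs b le_rfl, hout.ne] using h0
    refine ⟨k, Nat.mem_rfind.2 ⟨by simp [h0], fun {m} hm => by simpa using hk m hm⟩, by simp [h0]⟩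
  · rintro ⟨k, hk, rfl⟩
    obtain ⟨h0, hk⟩ := Nat.mem_rfind.1 hk
    have h0 : f (k ::ᵥ v) = 0 := by simpa using h0
    refine ⟨_, (hstar _).2 ⟨k, rfl, fun j hj => by simpa using hk hj⟩, ?_⟩
    simp [Run, h0, hs b le_rfl, hout.ne]

/-- Register `b` counts down from the recursion argument, `b + 1` counts up as the index, `out`
holds the current value and `b + 2` receives the next one. -/
theorem Computes.prec {n : ℕ} {f : List.Vector ℕ n → ℕ} {g : List.Vector ℕ (n + 2) → ℕ}
    (hf : Computes fun v => Part.some (f v)) (hg : Computes fun v => Part.some (g v)) :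
    Computes (n := n + 1) fun v => Part.some
      (Nat.rec (f v.tail) (fun y IH => g (y ::ᵥ IH ::ᵥ v.tail)) v.head) := by
  intro ins out b hins hout hne
  obtain ⟨P, hP⟩ := hf (fun i => ins i.succ) out (b + 3) (fun i => by have := hins i.succ; omega)
    (by omega) (fun i => hne _)
  obtain ⟨Q, hQ⟩ := hg (Fin.cons (b + 1) (Fin.cons out fun i => ins i.succ)) (b + 2) (b + 3)
    (fun i => by
      refine Fin.cases ?_ (fun i => Fin.cases ?_ (fun i => ?_) i) i
      · simp
      · simp; omega
      · have := hins i.succ; simp; omega)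
    (by omega)
    (fun i => by
      refine Fin.cases ?_ (fun i => Fin.cases ?_ (fun i => ?_) i) i
      · simp
      · simp; omega
      · have := hins i.succ; simp; omega)
  refine ⟨.comp (copy (ins 0) b (b + 2)) (.comp P (.comp (untilZero b
    (.comp Q (.comp (clear out) (.comp (move (b + 2) out) (inc (b + 1)))))) (clear (b + 1)))),
    fun s hs hso t => ?_⟩
  have h0 := hins 0
  set v := List.Vector.ofFn fun i : Fin n => s (ins i.succ) with hv
  set N := s (ins 0) with hN
  let F : ℕ → ℕ := fun k => Nat.rec (f v) (fun y IH => g (y ::ᵥ IH ::ᵥ v)) k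
  have hb : s b = 0 := hs b le_rfl
  have hb1 : s (b + 1) = 0 := hs _ (by omega)
  have hb2 : s (b + 2) = 0 := hs _ (by omega)
  have hPrun : ∀ t, P.Run (s + single b N) t ↔ t = s + single b N + single out (f v) := by
    intro t
    rw [hP _ (fun j hj => by rw [Finsupp.add_apply, hs j (by omega), single_eq_of_ne (by omega)]; rfl)
      (by rw [Finsupp.add_apply, hso, single_eq_of_ne (by omega)]; rfl)]
    have : (List.Vector.ofFn fun i : Fin n => (s + single b N) (ins i.succ)) = v := by
      rw [hv]
      congr 1
      funext i
      have := hins i.succ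
      simp [this.ne]
    rw [this]
    simp
  have hQrun : ∀ c k a t, Q.Run (s + single b c + single (b + 1) k + single out a) t ↔
      t = s + single b c + single (b + 1) k + single out a + single (b + 2) (g (k ::ᵥ a ::ᵥ v)) := by
    intro c k a t
    rw [hQ _ (fun j hj => by
        simp only [Finsupp.add_apply]
        rw [hs j (by omega), single_eq_of_ne (by omega), single_eq_of_ne (by omega),
          single_eq_of_ne (by omega)]; rfl)
      (by
        simp only [Finsupp.add_apply]
        rw [hb2, single_eq_of_ne (by omega), single_eq_of_ne (by omega),
          single_eq_of_ne (by omega)]; rfl)]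
    have : (List.Vector.ofFn fun i => (s + single b c + single (b + 1) k + single out a)
        ((Fin.cons (b + 1) (Fin.cons out fun i => ins i.succ) : Fin (n + 2) → ℕ) i)) =
        k ::ᵥ a ::ᵥ v := by
      have e1 : out ≠ b + 1 := by omega
      rw [ofFn_eq_cons, ofFn_eq_cons, hv]
      congr 1
      · simp [hb1, e1]
      · congr 1
        · simp [hso, hout.ne, e1]
        · congr 1
          funext i
          have h1 := hins i.succ
          have h2 : ins i.succ ≠ b + 1 := by omega
          simp [h1.ne, h2, hne]
    rw [this]
    simp
  have hloop := run_untilZero (c := b)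
    (P := .comp Q (.comp (clear out) (.comp (move (b + 2) out) (inc (b + 1)))))
    -- The loop invariant after `k` rounds.
    (fun k => s + single b (N - k) + single (b + 1) k + single out (F k)) N
    (fun i _ => by simp [hb, hout.ne]) (by
      intro k hk t
      rw [run_comp_of_iff fun _ => run_dec
        (u := s + single b (N - (k + 1)) + single (b + 1) k + single out (F k)) ?_,
        run_comp_of_iff (hQrun _ _ _), add_right_comm, run_comp_of_iff fun _ => run_clear ?_ _ _,
        run_comp_of_iff fun _ => run_move (by omega) ?_ _ _]
      · simp only [Run, single_add]
        rw [iff_iff_eq]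
        congr 1
        abel
      · simp [hb2]
      · simp only [Finsupp.add_apply]
        rw [hso, single_eq_of_ne (by omega), single_eq_of_ne (by omega),
          single_eq_of_ne (by omega)]; rfl
      · have : N - k = N - (k + 1) + 1 := by omega
        rw [this, single_add]
        abel)
  simp only [Nat.sub_zero, single_zero, add_zero, Nat.sub_self] at hloop
  rw [show F 0 = f v from rfl] at hloop
  rw [run_comp_of_iff fun _ => run_copy (by omega) (by omega) (by omega) hb2 _,
    run_comp_of_iff hPrun, run_comp_of_iff hloop, add_right_comm, run_clear]
  · rw [ofFn_eq_cons]
    simp only [Part.mem_some_iff, exists_eq_left, List.Vector.tail_cons, List.Vector.head_cons]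
    rfl
  · have : out ≠ b + 1 := by omega
    simp [hb1, this]

theorem computes_of_primrec' {n : ℕ} {f : List.Vector ℕ n → ℕ} (hf : Nat.Primrec' f) :
    Computes fun v => Part.some (f v) := by
  induction hf with
  | zero => exact computes_zero
  | succ => exact computes_succ
  | get i => exact computes_get i
  | comp g _ _ hf hg =>
    refine hf.comp hg fun v z => ?_
    simp only [Part.mem_some_iff]
    constructor
    · rintro rfl
      exact ⟨_, fun i => rfl, rfl⟩
    · rintro ⟨y, hy, rfl⟩
      rw [funext hy]
  | prec _ _ hf hg => exact hf.prec hg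

theorem computes_of_partrec' {n : ℕ} {f : List.Vector ℕ n →. ℕ} (hf : Nat.Partrec' f) :
    Computes f := by
  induction hf with
  | prim h => exact computes_of_primrec' h
  | @comp m n f g _ _ hf hg =>
    refine hf.comp hg fun v z => ?_
    -- In the `Part` monad a vector of computations yields `y` iff each component yields its entry.
    have hm : ∀ {k : ℕ} (y : List.Vector ℕ k) (h : Fin k → Part ℕ),
        y ∈ List.Vector.mOfFn h ↔ ∀ i, y.get i ∈ h i := by
      intro k y h
      induction k with
      | zero => simp [List.Vector.mOfFn, pure, List.Vector.eq_nil]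
      | succ k ih =>
        simp only [List.Vector.mOfFn, Part.bind_eq_bind, Part.mem_bind_iff, Part.pure_eq_some,
          Part.mem_some_iff, ih, Fin.forall_fin_succ]
        constructor
        · rintro ⟨a, ha, z, hz, rfl⟩
          exact ⟨ha, hz⟩
        · rintro ⟨h0, h1⟩
          exact ⟨_, h0, y.tail, fun i => by simpa using h1 i, by
            rw [List.Vector.get_zero, List.Vector.cons_head_tail]⟩
    have hbind : ∀ (f : List.Vector ℕ n → Part ℕ) (h : Fin n → Part ℕ),
        z ∈ (List.Vector.mOfFn h).bind f ↔
          ∃ y : Fin n → ℕ, (∀ i, y i ∈ h i) ∧ z ∈ f (List.Vector.ofFn y) := by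
      intro f h
      simp only [Part.mem_bind_iff, hm]
      constructor
      · rintro ⟨y, hy, hz⟩
        exact ⟨y.get, hy, by rwa [List.Vector.ofFn_get]⟩
      · rintro ⟨y, hy, hz⟩
        exact ⟨_, fun i => by simpa using hy i, hz⟩
    exact hbind f fun i => g i v
  | rfind _ hf => exact hf.rfind

end FOReg
-- Simulation of programs on two counters
namespace FOReg

open TransitionSystem Finsupp

/-- The asynchronous product of two counters. -/
abbrev grid : TransitionSystem (Fin 3 ⊕ Fin 3) := counter.asyncProduct counter

/-- Reachability in `grid`, as a relation between pairs of numbers. -/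
abbrev gridReach (r : RegularExpression (Fin 3 ⊕ Fin 3)) (v w : ℕ × ℕ) : Prop := grid.Reach r v w

theorem grid_reach_comp (r s : RegularExpression (Fin 3 ⊕ Fin 3)) (v w : ℕ × ℕ) :
    gridReach (.comp r s) v w ↔ ∃ u : ℕ × ℕ, gridReach r v u ∧ gridReach s u w :=
  grid.reach_comp r s v w

theorem grid_reach_inc_left (v w : ℕ × ℕ) :
    gridReach (.char (.inl 0)) v w ↔ w = (v.1 + 1, v.2) := by
  obtain ⟨x, y⟩ := v
  obtain ⟨z, u⟩ := w
  refine (grid.reach_char _ _ _).trans ?_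
  simp only [Prod.mk.injEq]
  exact and_congr Iff.rfl eq_comm

theorem grid_reach_dec_left (v w : ℕ × ℕ) :
    gridReach (.char (.inl 1)) v w ↔ v = (w.1 + 1, w.2) := by
  obtain ⟨x, y⟩ := v
  obtain ⟨z, u⟩ := w
  refine (grid.reach_char _ _ _).trans ?_
  simp only [Prod.mk.injEq]
  exact Iff.rfl

theorem grid_reach_zero_left (v w : ℕ × ℕ) :
    gridReach (.char (.inl 2)) v w ↔ v.1 = 0 ∧ w = v := by
  obtain ⟨x, y⟩ := v
  obtain ⟨z, u⟩ := w
  refine (grid.reach_char _ _ _).trans ?_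
  simp only [Prod.mk.injEq]
  change (x = 0 ∧ z = 0) ∧ y = u ↔ _
  omega

theorem grid_reach_inc_right (v w : ℕ × ℕ) :
    gridReach (.char (.inr 0)) v w ↔ w = (v.1, v.2 + 1) := by
  obtain ⟨x, y⟩ := v
  obtain ⟨z, u⟩ := w
  refine (grid.reach_char _ _ _).trans ?_
  simp only [Prod.mk.injEq]
  change u = y + 1 ∧ x = z ↔ _
  omega

theorem grid_reach_dec_right (v w : ℕ × ℕ) :
    gridReach (.char (.inr 1)) v w ↔ v = (w.1, w.2 + 1) := by
  obtain ⟨x, y⟩ := v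
  obtain ⟨z, u⟩ := w
  refine (grid.reach_char _ _ _).trans ?_
  simp only [Prod.mk.injEq]
  change y = u + 1 ∧ x = z ↔ _
  omega

theorem grid_reach_zero_right (v w : ℕ × ℕ) :
    gridReach (.char (.inr 2)) v w ↔ v.2 = 0 ∧ w = v := by
  obtain ⟨x, y⟩ := v
  obtain ⟨z, u⟩ := w
  refine (grid.reach_char _ _ _).trans ?_
  simp only [Prod.mk.injEq]
  change (y = 0 ∧ u = 0) ∧ x = z ↔ _
  omega

/-- The `n`-fold concatenation of a regular expression. -/
def regexPow {A : Type} (r : RegularExpression A) : ℕ → RegularExpression A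
  | 0 => .epsilon
  | n + 1 => .comp r (regexPow r n)

/-- Between one and `n` repetitions of a regular expression. -/
def regexBetween {A : Type} (r : RegularExpression A) : ℕ → RegularExpression A
  | 0 => .zero
  | n + 1 => .plus (regexBetween r n) (regexPow r (n + 1))

theorem reach_regexBetween {A : Type} (G : TransitionSystem A) (r : RegularExpression A) (n : ℕ)
    (v w : G.V) : G.Reach (regexBetween r n) v w ↔
      ∃ k, 0 < k ∧ k ≤ n ∧ G.Reach (regexPow r k) v w := by
  induction n with
  | zero =>
    simp only [regexBetween, G.reach_zero, false_iff]
    rintro ⟨k, h1, h2, -⟩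
    omega
  | succ n ih =>
    rw [regexBetween, G.reach_plus, ih]
    constructor
    · rintro (⟨k, h1, h2, h⟩ | h)
      · exact ⟨k, h1, by omega, h⟩
      · exact ⟨n + 1, by omega, le_rfl, h⟩
    · rintro ⟨k, h1, h2, h⟩
      rcases Nat.lt_or_eq_of_le h2 with h2 | rfl
      · exact .inl ⟨k, h1, by omega, h⟩
      · exact .inr h

/-- The paths described by `r` move `a` units out of the first counter and `d` units into the
second one. -/
def IsTransfer (r : RegularExpression (Fin 3 ⊕ Fin 3)) (a d : ℕ) : Prop :=
  ∀ v w : ℕ × ℕ, gridReach r v w ↔ v.1 = w.1 + a ∧ w.2 = v.2 + d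

theorem isTransfer_dec : IsTransfer (.char (.inl 1)) 1 0 := by
  intro v w
  rw [grid_reach_dec_left, Prod.ext_iff]
  simp only
  omega

theorem isTransfer_inc : IsTransfer (.char (.inr 0)) 0 1 := by
  intro v w
  rw [grid_reach_inc_right, Prod.ext_iff]
  simp only
  omega

/-- Only decrements of the first counter can block, and it suffices for both parts in turn iff it
suffices for the sum `a + a'`. -/
theorem IsTransfer.comp {r s : RegularExpression (Fin 3 ⊕ Fin 3)} {a d a' d' : ℕ}
    (hr : IsTransfer r a d) (hs : IsTransfer s a' d') : IsTransfer (.comp r s) (a + a') (d + d') := by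
  intro v w
  rw [grid_reach_comp]
  constructor
  · rintro ⟨u, hu, hw⟩
    rw [hr] at hu
    rw [hs] at hw
    omega
  · rintro h
    exact ⟨(w.1 + a', v.2 + d), (hr _ _).2 ⟨by simp only; omega, rfl⟩,
      (hs _ _).2 ⟨rfl, by simp only; omega⟩⟩

theorem IsTransfer.pow {r : RegularExpression (Fin 3 ⊕ Fin 3)} {a d : ℕ}
    (hr : IsTransfer r a d) (n : ℕ) : IsTransfer (regexPow r n) (n * a) (n * d) := by
  induction n with
  | zero =>
    intro v w
    refine (grid.reach_epsilon _ _).trans ?_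
    refine Prod.ext_iff.trans ?_
    omega
  | succ n ih =>
    have := hr.comp ih
    rwa [add_comm a, add_comm d, ← Nat.succ_mul, ← Nat.succ_mul] at this

theorem IsTransfer.reach_star {r : RegularExpression (Fin 3 ⊕ Fin 3)} {a d : ℕ}
    (hr : IsTransfer r a d) (v w : ℕ × ℕ) :
    gridReach (.star r) v w ↔ ∃ n, v.1 = w.1 + n * a ∧ w.2 = v.2 + n * d := by
  refine (TransitionSystem.reach_star grid r v w).trans ?_
  constructor
  · intro h
    induction h with
    | refl => exact ⟨0, by simp, by simp⟩
    | tail _ h ih =>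
      obtain ⟨n, h1, h2⟩ := ih
      obtain ⟨h3, h4⟩ := (hr _ _).1 h
      exact ⟨n + 1, by rw [h1, h3]; ring, by rw [h4, h2]; ring⟩
  · rintro ⟨n, h⟩
    induction n generalizing w with
    | zero =>
      obtain rfl : v = w := Prod.ext (by omega) (by omega)
      exact .refl
    | succ n ih =>
      simp only [Nat.succ_mul] at h
      exact .tail (ih (w.1 + a, v.2 + n * d) ⟨by simp only; omega, by simp only⟩)
        ((hr _ _).2 ⟨by simp only, by simp only; omega⟩)

/-- When the first counter is zero, move the content of the second one there. -/
def regexReturn : RegularExpression (Fin 3 ⊕ Fin 3) :=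
  .comp (.char (.inl 2)) (.comp (.star (.comp (.char (.inr 1)) (.char (.inl 0))))
    (.char (.inr 2)))

/-- The first zero test forces the loop preceding this expression to have emptied the first counter;
the last one forces the move back to be complete. -/
theorem grid_reach_regexReturn (v w : ℕ × ℕ) :
    gridReach regexReturn v w ↔ v.1 = 0 ∧ w = (v.2, 0) := by
  have h1 : ∀ v w : ℕ × ℕ, gridReach (.comp (.char (.inr 1)) (.char (.inl 0))) v w ↔
      w.1 = v.1 + 1 ∧ v.2 = w.2 + 1 := by
    intro v w
    rw [grid_reach_comp]
    simp only [grid_reach_dec_right, grid_reach_inc_left]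
    constructor
    · rintro ⟨u, rfl, rfl⟩
      simp
    · rintro ⟨h1, h2⟩
      exact ⟨(v.1, w.2), by rw [← h2], by rw [← h1]⟩
  have h2 : ∀ v w : ℕ × ℕ,
      gridReach (.star (.comp (.char (.inr 1)) (.char (.inl 0)))) v w ↔
      ∃ n, w.1 = v.1 + n ∧ v.2 = w.2 + n := by
    intro v w
    refine (TransitionSystem.reach_star grid _ v w).trans ?_
    constructor
    · intro h
      induction h with
      | refl => exact ⟨0, by simp, by simp⟩
      | tail _ h ih =>
        obtain ⟨n, h3, h4⟩ := ih
        obtain ⟨h5, h6⟩ := (h1 _ _).1 h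
        exact ⟨n + 1, by omega, by omega⟩
    · rintro ⟨n, h⟩
      induction n generalizing w with
      | zero =>
        obtain rfl : v = w := Prod.ext (by omega) (by omega)
        exact .refl
      | succ n ih =>
        exact .tail (ih (v.1 + n, w.2 + 1) ⟨rfl, by simp only; omega⟩)
          ((h1 _ _).2 ⟨by simp only; omega, rfl⟩)
  rw [regexReturn, grid_reach_comp]
  simp only [grid_reach_zero_left, grid_reach_comp, grid_reach_zero_right, h2]
  constructor
  · rintro ⟨u, ⟨hv, rfl⟩, u', ⟨n, h3, h4⟩, h5, rfl⟩
    exact ⟨hv, Prod.ext (by simp only; omega) h5⟩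
  · rintro ⟨hv, rfl⟩
    exact ⟨v, ⟨hv, rfl⟩, (v.2, 0), ⟨v.2, by simp only; omega, by simp only; omega⟩, rfl, rfl⟩

/-- Multiply the first counter by `p`, with the help of the second one. -/
def regexMul (p : ℕ) : RegularExpression (Fin 3 ⊕ Fin 3) :=
  .comp (.star (.comp (.char (.inl 1)) (regexPow (.char (.inr 0)) p))) regexReturn

theorem grid_reach_regexMul (p n : ℕ) (w : ℕ × ℕ) :
    gridReach (regexMul p) (n, 0) w ↔ w = (n * p, 0) := by
  have h := (isTransfer_dec.comp (isTransfer_inc.pow p)).reach_star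
  simp only [mul_zero, mul_one, zero_add, add_zero] at h
  rw [regexMul, grid_reach_comp]
  simp only [grid_reach_regexReturn, h]
  constructor
  · rintro ⟨u, ⟨k, h1, h2⟩, h3, rfl⟩
    simp only [h3, zero_add] at h1
    rw [h2, h1]
    simp
  · rintro rfl
    exact ⟨(0, n * p), ⟨n, by simp, by simp⟩, rfl, rfl⟩

/-- Divide the first counter by `p` if it is divisible by `p`. -/
def regexDiv (p : ℕ) : RegularExpression (Fin 3 ⊕ Fin 3) :=
  .comp (.star (.comp (regexPow (.char (.inl 1)) p) (.char (.inr 0)))) regexReturn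

theorem grid_reach_regexDiv (p n : ℕ) (w : ℕ × ℕ) :
    gridReach (regexDiv p) (n, 0) w ↔ ∃ k, n = k * p ∧ w = (k, 0) := by
  have h := ((isTransfer_dec.pow p).comp isTransfer_inc).reach_star
  simp only [mul_zero, mul_one, zero_add, add_zero] at h
  rw [regexDiv, grid_reach_comp]
  simp only [grid_reach_regexReturn, h]
  constructor
  · rintro ⟨u, ⟨k, h1, h2⟩, h3, rfl⟩
    exact ⟨k, by simpa [h3] using h1, by simp [h2]⟩
  · rintro ⟨k, rfl, rfl⟩
    exact ⟨(0, k), ⟨k, by simp, by simp⟩, rfl, rfl⟩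

/-- Test that the first counter is not divisible by `p`. -/
def regexNotDvd (p : ℕ) : RegularExpression (Fin 3 ⊕ Fin 3) :=
  .comp (.star (.comp (regexPow (.char (.inl 1)) p) (regexPow (.char (.inr 0)) p)))
    (.comp (regexBetween (.comp (.char (.inl 1)) (.char (.inr 0))) (p - 1)) regexReturn)

/-- Division with remainder: full blocks of `p` units are moved, then a remainder between `1` and `p
- 1`, after which the first counter must be empty. All `n` units arrive in the second counter, so
the return restores `n`. -/
theorem grid_reach_regexNotDvd {p : ℕ} (hp : 0 < p) (n : ℕ) (w : ℕ × ℕ) :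
    gridReach (regexNotDvd p) (n, 0) w ↔ ¬ p ∣ n ∧ w = (n, 0) := by
  have h := ((isTransfer_dec.pow p).comp (isTransfer_inc.pow p)).reach_star
  have h' : ∀ v w : ℕ × ℕ, gridReach (regexBetween (.comp (.char (.inl 1)) (.char (.inr 0))) (p - 1))
      v w ↔ ∃ k, 0 < k ∧ k ≤ p - 1 ∧ v.1 = w.1 + k ∧ w.2 = v.2 + k := by
    intro v w
    refine (reach_regexBetween grid _ _ v w).trans ?_
    refine exists_congr fun k => and_congr_right fun _ => and_congr_right fun _ => ?_
    have := (isTransfer_dec.comp isTransfer_inc).pow k v w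
    simpa using this
  simp only [mul_zero, mul_one, zero_add, add_zero] at h
  rw [regexNotDvd, grid_reach_comp]
  simp only [grid_reach_comp, grid_reach_regexReturn, h, h']
  constructor
  · rintro ⟨u, ⟨k, h1, h2⟩, u', ⟨r, h3, h4, h5, h6⟩, h7, rfl⟩
    have hn : n = k * p + r := by omega
    refine ⟨fun hd => ?_, Prod.ext (by simp only; omega) rfl⟩
    rw [hn] at hd
    have := (Nat.dvd_add_right (Dvd.intro_left k rfl)).1 hd
    exact absurd (Nat.le_of_dvd h3 this) (by omega)
  · rintro ⟨hd, rfl⟩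
    have h1 : n % p ≠ 0 := fun h0 => hd (Nat.dvd_of_mod_eq_zero h0)
    have h2 := Nat.mod_lt n hp
    have h3 := Nat.div_add_mod' n p
    exact ⟨(n % p, n / p * p), ⟨n / p, by simp only; omega, by simp only; omega⟩, (0, n),
      ⟨n % p, by omega, by omega, by simp only; omega, by simp only; omega⟩, rfl, rfl⟩

/-- A store is encoded by the exponents in a prime factorization. -/
noncomputable def encodeStore (s : ℕ →₀ ℕ) : ℕ := s.prod fun i e => Nat.nth Nat.Prime i ^ e

theorem prime_nth (i : ℕ) : (Nat.nth Nat.Prime i).Prime := Nat.prime_nth_prime i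

theorem encodeStore_zero : encodeStore 0 = 1 := prod_zero_index

theorem encodeStore_add_single (s : ℕ →₀ ℕ) (i m : ℕ) :
    encodeStore (s + single i m) = encodeStore s * Nat.nth Nat.Prime i ^ m := by
  rw [encodeStore, prod_add_index' (by simp) (by intros; rw [pow_add]), prod_single_index (by simp)]
  rfl

theorem nth_prime_dvd_encodeStore (s : ℕ →₀ ℕ) (i : ℕ) :
    Nat.nth Nat.Prime i ∣ encodeStore s ↔ s i ≠ 0 := by
  constructor
  · intro h
    obtain ⟨j, hj, h⟩ := (Prime.dvd_finsetProd_iff (prime_nth i).prime _).1 h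
    have h := (Nat.prime_dvd_prime_iff_eq (prime_nth i) (prime_nth j)).1
      ((prime_nth i).dvd_of_dvd_pow h)
    obtain rfl := Nat.nth_injective Nat.infinite_setOfPred_prime h
    exact mem_support_iff.1 hj
  · intro h
    obtain ⟨m, hm⟩ := Nat.exists_eq_succ_of_ne_zero h
    rw [← erase_add_single i s, encodeStore_add_single, hm]
    exact (dvd_pow_self _ (Nat.succ_ne_zero m)).mul_left _

/-- The regular expression that simulates a program on the two counters. -/
noncomputable def Program.toRegex : Program → RegularExpression (Fin 3 ⊕ Fin 3)
  | skip => .epsilon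
  | inc i => regexMul (Nat.nth Nat.Prime i)
  | dec i => regexDiv (Nat.nth Nat.Prime i)
  | zero i => regexNotDvd (Nat.nth Nat.Prime i)
  | comp P Q => .comp P.toRegex Q.toRegex
  | plus P Q => .plus P.toRegex Q.toRegex
  | star P => .star P.toRegex

/-- Control structures agree on both sides, so only the instructions need arithmetic. Asserting that
every endpoint is again the code of a store is what makes the induction pass through sequences and
loops. -/
theorem Program.grid_reach_toRegex (P : Program) (s : ℕ →₀ ℕ) (w : ℕ × ℕ) :
    gridReach P.toRegex (encodeStore s, 0) w ↔ ∃ t, P.Run s t ∧ w = (encodeStore t, 0) := by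
  induction P generalizing s w with
  | skip =>
    refine (grid.reach_epsilon _ _).trans ?_
    simp only [Run, exists_eq_left]
    exact eq_comm
  | inc i => simp [toRegex, grid_reach_regexMul, Run, encodeStore_add_single]
  | dec i =>
    rw [toRegex, grid_reach_regexDiv]
    constructor
    · rintro ⟨k, hk, rfl⟩
      have hs := (nth_prime_dvd_encodeStore s i).1 (Dvd.intro_left k hk.symm)
      -- Divisibility gives a unit in register `i`; cancelling the prime identifies `k` as the code
      -- of the store without it.
      have h : s = (s - single i 1) + single i 1 :=
        (tsub_add_cancel_of_le (single_le_iff.2 (Nat.one_le_iff_ne_zero.2 hs))).symm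
      refine ⟨_, h, ?_⟩
      rw [h, encodeStore_add_single, pow_one] at hk
      rw [Nat.eq_of_mul_eq_mul_right (prime_nth i).pos hk]
    · rintro ⟨t, ht, rfl⟩
      have ht : s = t + single i 1 := ht
      exact ⟨_, by rw [ht, encodeStore_add_single, pow_one], rfl⟩
  | zero i =>
    rw [toRegex, grid_reach_regexNotDvd (prime_nth i).pos, nth_prime_dvd_encodeStore, not_not]
    constructor
    · rintro ⟨h, rfl⟩
      exact ⟨s, ⟨h, rfl⟩, rfl⟩
    · rintro ⟨t, ⟨h, rfl⟩, rfl⟩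
      exact ⟨h, rfl⟩
  | comp P Q hP hQ =>
    rw [toRegex, grid_reach_comp]
    constructor
    · rintro ⟨u, hu, hw⟩
      obtain ⟨t, ht, rfl⟩ := (hP _ _).1 hu
      obtain ⟨t', ht', rfl⟩ := (hQ _ _).1 hw
      exact ⟨t', ⟨t, ht, ht'⟩, rfl⟩
    · rintro ⟨t', ⟨t, ht, ht'⟩, rfl⟩
      exact ⟨_, (hP _ _).2 ⟨t, ht, rfl⟩, (hQ _ _).2 ⟨t', ht', rfl⟩⟩
  | plus P Q hP hQ =>
    refine (grid.reach_plus _ _ _ _).trans ((or_congr (hP _ _) (hQ _ _)).trans ?_)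
    rw [← exists_or]
    simp only [Run, or_and_right]
  | star P hP =>
    refine (grid.reach_star _ _ _).trans ?_
    constructor
    · intro h
      induction h with
      | refl => exact ⟨s, .refl, rfl⟩
      | tail _ h ih =>
        obtain ⟨t, ht, rfl⟩ := ih
        obtain ⟨t', ht', rfl⟩ := (hP _ _).1 h
        exact ⟨t', .tail ht ht', rfl⟩
    · rintro ⟨t, ht, rfl⟩
      exact Relation.ReflTransGen.lift (fun t => ((encodeStore t, 0) : ℕ × ℕ))
        (fun a b h => (hP a _).2 ⟨b, h, rfl⟩) _ _ ht

/-- The regular expression that loads `n` into the register `0` and then continues with `r`. -/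
noncomputable def regexLoad (r : RegularExpression (Fin 3 ⊕ Fin 3)) :
    ℕ → RegularExpression (Fin 3 ⊕ Fin 3)
  | 0 => r
  | n + 1 => .comp (regexMul (Nat.nth Nat.Prime 0)) (regexLoad r n)

theorem grid_reach_regexLoad (r : RegularExpression (Fin 3 ⊕ Fin 3)) (n : ℕ) (s : ℕ →₀ ℕ)
    (w : ℕ × ℕ) : gridReach (regexLoad r n) (encodeStore s, 0) w ↔
      gridReach r (encodeStore (s + single 0 n), 0) w := by
  induction n generalizing s with
  | zero => simp [regexLoad]
  | succ n ih =>
    have := ih (s + single 0 1)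
    rw [encodeStore_add_single, pow_one, add_assoc, ← single_add, add_comm 1] at this
    rw [regexLoad, grid_reach_comp]
    simp only [grid_reach_regexMul, exists_eq_left, this]

/-- Set up the empty store and continue with `r`. -/
def regexInit (r : RegularExpression (Fin 3 ⊕ Fin 3)) : RegularExpression (Fin 3 ⊕ Fin 3) :=
  .comp (.char (.inl 2)) (.comp (.char (.inr 2)) (.comp (.char (.inl 0)) r))

/-- The two zero tests force the start vertex to be `(0, 0)`, and one increment produces `1`, the
code of the empty store. This is why quantifying over all vertices does no harm. -/
theorem exists_grid_reach_regexInit (r : RegularExpression (Fin 3 ⊕ Fin 3)) :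
    (∃ v w : ℕ × ℕ, gridReach (regexInit r) v w) ↔
      ∃ w : ℕ × ℕ, gridReach r (encodeStore 0, 0) w := by
  rw [encodeStore_zero]
  simp only [regexInit, grid_reach_comp, grid_reach_zero_left, grid_reach_zero_right,
    grid_reach_inc_left]
  constructor
  · rintro ⟨v, w, _, ⟨h1, rfl⟩, _, ⟨h2, rfl⟩, _, rfl, h⟩
    rw [h1, h2] at h
    exact ⟨w, h⟩
  · rintro ⟨w, h⟩
    exact ⟨(0, 0), w, _, ⟨rfl, rfl⟩, _, ⟨rfl, rfl⟩, _, rfl, h⟩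

/-- The halting problem of a partial recursive function reduces to the FO(Reg)-theory of the
asynchronous product of two counters. -/
theorem computablePred_dom_of_grid (h : grid.HasDecidableTheory) {φ : ℕ →. ℕ} (hφ : Partrec φ) :
    ComputablePred fun n => (φ n).Dom := by
  obtain ⟨f, hf, hfφ⟩ := h
  -- Input in register `0`, output in `1`, scratch space from `2` on.
  obtain ⟨P, hP⟩ := computes_of_partrec' (Nat.Partrec'.part_iff₁.2 hφ) (fun _ => 0) 1 2
    (by simp) (by simp) (by simp)
  have hreach : ∀ n, (∃ v w : ℕ × ℕ, gridReach (regexInit (regexLoad P.toRegex n)) v w) ↔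
      (φ n).Dom := by
    intro n
    rw [exists_grid_reach_regexInit]
    simp only [grid_reach_regexLoad, zero_add, P.grid_reach_toRegex]
    have := hP (single 0 n) (fun j hj => single_eq_of_ne (by omega)) (single_eq_of_ne (by omega))
    simp only [this, Part.dom_iff_mem]
    constructor
    · rintro ⟨_, _, ⟨y, hy, _⟩, _⟩
      exact ⟨y, by simpa using hy⟩
    · rintro ⟨y, hy⟩
      exact ⟨_, _, ⟨y, by simpa using hy, rfl⟩, rfl⟩
  let ψ : ℕ → (lang (Fin 3 ⊕ Fin 3)).Sentence := fun n =>
    .all (.all (.imp (.rel (.reach (regexInit (regexLoad P.toRegex n)))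
      ![.var (.inr 0), .var (.inr 1)]) .falsum))
  have hψ : ∀ n, f (codeFormula (ψ n)) = true ↔ ¬ (φ n).Dom := by
    intro n
    rw [hfφ, models_all_all_not_reach, ← hreach n]
    push Not
    rfl
  have hcode : Primrec fun n => codeFormula (ψ n) := by
    have hload : Primrec fun n => codeRegex (regexLoad P.toRegex n) := by
      refine (Primrec.nat_rec₁ (codeRegex P.toRegex)
        (f := fun _ c => Nat.pair 4 (Nat.pair (codeRegex (regexMul (Nat.nth Nat.Prime 0))) c))
        ?_).of_eq fun n => ?_
      · exact Primrec₂.natPair.comp (.const _) (Primrec₂.natPair.comp (.const _) .snd)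
      · induction n with
        | zero => rfl
        | succ n ih =>
          simp only [regexLoad, codeRegex, ← ih]
    have hpair : ∀ (a : ℕ) {g : ℕ → ℕ}, Primrec g → Primrec fun n => Nat.pair a (g n) :=
      fun a g hg => Primrec₂.natPair.comp (.const a) hg
    have hpair' : ∀ (a : ℕ) {g : ℕ → ℕ}, Primrec g → Primrec fun n => Nat.pair (g n) a :=
      fun a g hg => Primrec₂.natPair.comp hg (.const a)
    -- Apart from the code of the loaded expression, every component of the nested pairs is constant
    -- in `n`.
    exact hpair _ (hpair _ (hpair _ (hpair' _ (hpair _ (hpair' _ (hpair _ (hpair _ (hpair _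
      (hpair _ (hpair _ (hpair _ hload)))))))))))
  refine ComputablePred.computable_iff.2 ⟨fun n => !(f (codeFormula (ψ n))), ?_, ?_⟩
  · exact Primrec.not.to_comp.comp (hf.comp hcode.to_comp)
  · funext n
    have := hψ n
    simp only [Bool.not_eq_eq_eq_not, Bool.not_true, eq_iff_iff, ← Bool.not_eq_true]
    tauto

theorem not_hasDecidableTheory_grid : ¬ grid.HasDecidableTheory := by
  intro h
  have hφ : Partrec fun n : ℕ => (Denumerable.ofNat Nat.Partrec.Code n).eval 0 :=
    Nat.Partrec.Code.eval_part.comp (Computable.ofNat _) (.const 0)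
  refine ComputablePred.halting_problem 0 ?_
  obtain ⟨g, hg, hgφ⟩ := ComputablePred.computable_iff.1 (computablePred_dom_of_grid h hφ)
  refine ComputablePred.computable_iff.2
    ⟨fun c => g (Encodable.encode c), hg.comp Computable.encode, ?_⟩
  funext c
  have := congrFun hgφ (Encodable.encode c)
  simpa using this

end FOReg
namespace FOReg

open Relation

/-! ### Eventual periodicity in finite sets -/

section Sequences

variable {X : Type*} [Finite X] {s : ℕ → X} {T : ℕ}

/-- A sequence in a finite set in which each element determines the next one is eventually
periodic. -/
theorem seq_eq_of_modEq (hs : ∀ i j, s i = s j → s (i + 1) = s (j + 1)) (hT : Nat.card X ≤ T)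
    {n m : ℕ} (hn : T ≤ n) (hm : T ≤ m) (h : n ≡ m [MOD T.factorial]) : s n = s m := by
  wlog hnm : n ≤ m generalizing n m
  · exact (this hm hn h.symm (by omega)).symm
  -- By pigeonhole a value repeats among the indices up to `T`. The distance is at most `T`, so it
  -- divides `T!`, which is a period independent of the sequence.
  obtain ⟨i, j, hij, hjT, he⟩ : ∃ i j, i < j ∧ j ≤ T ∧ s i = s j := by
    have := Fintype.ofFinite X
    obtain ⟨a, b, hab, he⟩ := Fintype.exists_ne_map_eq_of_card_lt (fun i : Fin (T + 1) => s i)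
      (by rw [Fintype.card_fin, ← Nat.card_eq_fintype_card]; omega)
    rcases lt_or_gt_of_ne hab with h | h
    · exact ⟨a, b, h, by omega, he⟩
    · exact ⟨b, a, h, by omega, he.symm⟩
  obtain ⟨p, rfl⟩ := Nat.exists_eq_add_of_lt hij
  have hstep : ∀ d, s (i + d) = s (i + p + 1 + d) := by
    intro d
    induction d with
    | zero => exact he
    | succ d ih => exact hs _ _ ih
  have hper : ∀ c k, i ≤ k → s k = s (k + (p + 1) * c) := by
    intro c
    induction c with
    | zero => simp
    | succ c ih =>
      intro k hk
      obtain ⟨d, rfl⟩ := Nat.exists_eq_add_of_le hk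
      rw [hstep d, ih _ (by omega)]
      congr 1
      ring
  obtain ⟨e, he⟩ := (Nat.modEq_iff_dvd' hnm).1 h
  obtain ⟨c, hc⟩ : p + 1 ∣ T.factorial := Nat.dvd_factorial (by omega) (by omega)
  rw [hper (c * e) n (by omega)]
  congr 1
  rw [← mul_assoc, ← hc, ← he]
  omega

/-- Monotonicity and periodicity give `s n ≤ s (T + T! * n) = s T`: an increasing sequence of this
kind stabilises by `T`. -/
theorem seq_le_of_monotone [PartialOrder X] (hs : ∀ i j, s i = s j → s (i + 1) = s (j + 1))
    (hT : Nat.card X ≤ T) (hmono : Monotone s) (n : ℕ) : s n ≤ s T := by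
  have h1 : n ≤ T + T.factorial * n :=
    le_add_left (Nat.le_mul_of_pos_left n (Nat.factorial_pos T))
  refine (hmono h1).trans (le_of_eq (seq_eq_of_modEq hs hT (by omega) le_rfl ?_))
  simp [Nat.ModEq]

end Sequences

/-! ### Decomposition of paths -/

section Excursions

variable {V : Type*} {R : V → V → Prop} (Y : V → Prop)

/-- Splitting a path at its last exit from a set. -/
theorem reflTransGen_last_exit {u v : V} (h : ReflTransGen R u v) (hu : Y u) (hv : ¬ Y v) :
    ∃ a c, Y a ∧ ¬ Y c ∧ ReflTransGen R u a ∧ R a c ∧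
      ReflTransGen (fun c d => ¬ Y c ∧ ¬ Y d ∧ R c d) c v := by
  induction h with
  | refl => exact absurd hu hv
  | @tail b v h hR ih =>
    by_cases hb : Y b
    · exact ⟨b, v, hb, hv, h, hR, .refl⟩
    · obtain ⟨a, c, ha, hc, h1, h2, h3⟩ := ih hb
      exact ⟨a, c, ha, hc, h1, h2, h3.tail ⟨hb, hv, hR⟩⟩

/-- A path between points of a set consists of steps in the set and of excursions. -/
theorem reflTransGen_excursion {u v : V} (h : ReflTransGen R u v) (hu : Y u) (hv : Y v) :
    ReflTransGen (fun a b => Y a ∧ Y b ∧ (R a b ∨ ∃ c d, ¬ Y c ∧ ¬ Y d ∧ R a c ∧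
      ReflTransGen (fun c d => ¬ Y c ∧ ¬ Y d ∧ R c d) c d ∧ R d b)) u v := by
  -- The induction needs the case of an endpoint outside the set, where the unfinished excursion is
  -- recorded.
  suffices H : (Y v → ReflTransGen (fun a b => Y a ∧ Y b ∧ (R a b ∨ ∃ c d, ¬ Y c ∧ ¬ Y d ∧ R a c ∧
      ReflTransGen (fun c d => ¬ Y c ∧ ¬ Y d ∧ R c d) c d ∧ R d b)) u v) ∧
      (¬ Y v → ∃ a c, Y a ∧ ¬ Y c ∧ ReflTransGen (fun a b => Y a ∧ Y b ∧ (R a b ∨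
        ∃ c d, ¬ Y c ∧ ¬ Y d ∧ R a c ∧
        ReflTransGen (fun c d => ¬ Y c ∧ ¬ Y d ∧ R c d) c d ∧ R d b)) u a ∧ R a c ∧
        ReflTransGen (fun c d => ¬ Y c ∧ ¬ Y d ∧ R c d) c v) from H.1 hv
  clear hv
  induction h with
  | refl => exact ⟨fun _ => .refl, fun h => absurd hu h⟩
  | @tail b v _ hR ih =>
    by_cases hb : Y b
    · refine ⟨fun hv => (ih.1 hb).tail ⟨hb, hv, .inl hR⟩, fun hv => ?_⟩
      exact ⟨b, v, hb, hv, ih.1 hb, hR, .refl⟩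
    · obtain ⟨a, c, ha, hc, h1, h2, h3⟩ := ih.2 hb
      refine ⟨fun hv => h1.tail ⟨ha, hv, .inr ⟨c, b, hc, hb, h2, h3, hR⟩⟩, fun hv => ?_⟩
      exact ⟨a, c, ha, hc, h1, h2, h3.tail ⟨hb, hv, hR⟩⟩

end Excursions

/-! ### Automata for regular expressions -/

section Automata

variable {A : Type}

/-- The moves of an automaton with transitions `tr`, where the label `none` stands for the empty
word, on a transition system. -/
def Move {σ : Type} (G : TransitionSystem A) (tr : σ → Option A → σ → Prop) (c d : σ × G.V) :
    Prop :=
  (tr c.1 none d.1 ∧ d.2 = c.2) ∨ ∃ a, tr c.1 (some a) d.1 ∧ G.E a c.2 d.2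

/-- The automaton with transitions `tr`, initial states `s` and final states `f` recognizes
the language of `r`; this is expressed by its runs on transition systems. -/
def Recognizes {σ : Type} (tr : σ → Option A → σ → Prop) (s f : σ → Prop)
    (r : RegularExpression A) : Prop :=
  ∀ (G : TransitionSystem A) (v w : G.V),
    G.Reach r v w ↔ ∃ p q, s p ∧ f q ∧ ReflTransGen (Move G tr) (p, v) (q, w)

/-- The disjoint union of two automata, with additional empty transitions between them. -/
def sumTr {σ τ : Type} (tr : σ → Option A → σ → Prop) (tr' : τ → Option A → τ → Prop)
    (link : σ → τ → Prop) : σ ⊕ τ → Option A → σ ⊕ τ → Prop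
  | .inl p, a, .inl q => tr p a q
  | .inr p, a, .inr q => tr' p a q
  | .inl p, a, .inr q => a = none ∧ link p q
  | .inr _, _, .inl _ => False

section Sum

variable {σ τ : Type} {tr : σ → Option A → σ → Prop} {tr' : τ → Option A → τ → Prop}
  {link : σ → τ → Prop} {G : TransitionSystem A}

theorem move_sumTr_inl {p q : σ} {v w : G.V} (h : ReflTransGen (Move G tr) (p, v) (q, w)) :
    ReflTransGen (Move G (sumTr tr tr' link)) (.inl p, v) (.inl q, w) :=
  ReflTransGen.lift (r := Move G tr) (fun c : σ × G.V => ((.inl c.1 : σ ⊕ τ), c.2))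
    (fun _ _ h => h) _ _ h

theorem move_sumTr_inr {p q : τ} {v w : G.V} (h : ReflTransGen (Move G tr') (p, v) (q, w)) :
    ReflTransGen (Move G (sumTr tr tr' link)) (.inr p, v) (.inr q, w) :=
  ReflTransGen.lift (r := Move G tr') (fun c : τ × G.V => ((.inr c.1 : σ ⊕ τ), c.2))
    (fun _ _ h => h) _ _ h

theorem move_sumTr_from_inr {p : τ} {v w : G.V} {x : σ ⊕ τ}
    (h : ReflTransGen (Move G (sumTr tr tr' link)) (.inr p, v) (x, w)) :
    ∃ q, x = .inr q ∧ ReflTransGen (Move G tr') (p, v) (q, w) := by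
  generalize hc : (x, w) = c at h
  induction h generalizing x w with
  | refl =>
    obtain ⟨rfl, rfl⟩ := Prod.mk.inj hc
    exact ⟨p, rfl, .refl⟩
  | @tail b c _ hm ih =>
    subst hc
    obtain ⟨q, hq, h⟩ := ih rfl
    obtain ⟨b1, b2⟩ := b
    obtain rfl : b1 = .inr q := hq
    rcases x with x | x
    · rcases hm with ⟨h1, _⟩ | ⟨_, h1, _⟩ <;> exact h1.elim
    · exact ⟨x, rfl, h.tail hm⟩

/-- Links lead only from left to right, so a run crosses at most once. -/
theorem move_sumTr_from_inl {p : σ} {v w : G.V} {x : σ ⊕ τ}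
    (h : ReflTransGen (Move G (sumTr tr tr' link)) (.inl p, v) (x, w)) :
    (∃ q, x = .inl q ∧ ReflTransGen (Move G tr) (p, v) (q, w)) ∨
    ∃ q q₁ p₂ u, x = .inr q ∧ link q₁ p₂ ∧ ReflTransGen (Move G tr) (p, v) (q₁, u) ∧
      ReflTransGen (Move G tr') (p₂, u) (q, w) := by
  generalize hc : (x, w) = c at h
  induction h generalizing x w with
  | refl =>
    obtain ⟨rfl, rfl⟩ := Prod.mk.inj hc
    exact .inl ⟨p, rfl, .refl⟩
  | @tail b c _ hm ih =>
    subst hc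
    obtain ⟨b1, b2⟩ := b
    rcases ih rfl with ⟨q, hq, h⟩ | ⟨q, q₁, p₂, u, hq, hl, h1, h2⟩
    · obtain rfl : b1 = .inl q := hq
      rcases x with x | x
      · exact .inl ⟨x, rfl, h.tail hm⟩
      · rcases hm with ⟨h1, h2⟩ | ⟨_, h1, _⟩
        · obtain rfl : w = b2 := h2
          exact .inr ⟨x, q, x, w, rfl, h1.2, h, .refl⟩
        · exact absurd h1.1 (by simp)
    · obtain rfl : b1 = .inr q := hq
      rcases x with x | x
      · rcases hm with ⟨h1, _⟩ | ⟨_, h1, _⟩ <;> exact h1.elim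
      · exact .inr ⟨x, q₁, p₂, u, rfl, hl, h1, h2.tail hm⟩

end Sum

theorem Recognizes.plus {σ τ : Type} {tr : σ → Option A → σ → Prop}
    {tr' : τ → Option A → τ → Prop} {s f : σ → Prop} {s' f' : τ → Prop}
    {r r' : RegularExpression A} (h : Recognizes tr s f r) (h' : Recognizes tr' s' f' r') :
    Recognizes (sumTr tr tr' fun _ _ => False) (Sum.elim s s') (Sum.elim f f') (.plus r r') := by
  intro G v w
  rw [G.reach_plus, h G, h' G]
  constructor
  · rintro (⟨p, q, hp, hq, hm⟩ | ⟨p, q, hp, hq, hm⟩)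
    · exact ⟨.inl p, .inl q, hp, hq, move_sumTr_inl hm⟩
    · exact ⟨.inr p, .inr q, hp, hq, move_sumTr_inr hm⟩
  · rintro ⟨p | p, q, hp, hq, hm⟩
    · rcases move_sumTr_from_inl hm with ⟨q, rfl, hm'⟩ | ⟨_, _, _, _, _, hl, _⟩
      · exact .inl ⟨p, q, hp, hq, hm'⟩
      · exact hl.elim
    · obtain ⟨q, rfl, hm'⟩ := move_sumTr_from_inr hm
      exact .inr ⟨p, q, hp, hq, hm'⟩

theorem Recognizes.comp {σ τ : Type} {tr : σ → Option A → σ → Prop}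
    {tr' : τ → Option A → τ → Prop} {s f : σ → Prop} {s' f' : τ → Prop}
    {r r' : RegularExpression A} (h : Recognizes tr s f r) (h' : Recognizes tr' s' f' r') :
    Recognizes (sumTr tr tr' fun p q => f p ∧ s' q) (Sum.elim s fun _ => False)
      (Sum.elim (fun _ => False) f') (.comp r r') := by
  intro G v w
  rw [G.reach_comp]
  constructor
  · rintro ⟨u, hu, hw⟩
    obtain ⟨p, q, hp, hq, hm⟩ := (h G _ _).1 hu
    obtain ⟨p', q', hp', hq', hm'⟩ := (h' G _ _).1 hw
    have h1 : ReflTransGen (Move G (sumTr tr tr' fun p q => f p ∧ s' q)) (.inl p, v) (.inr p', u) :=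
      (move_sumTr_inl hm).tail (.inl ⟨⟨rfl, hq, hp'⟩, rfl⟩)
    exact ⟨.inl p, .inr q', hp, hq', h1.trans (move_sumTr_inr hm')⟩
  · rintro ⟨p | p, q, hp, hq, hm⟩
    · rcases move_sumTr_from_inl hm with ⟨q, rfl, hm⟩ | ⟨q, q₁, p₂, u, rfl, hl, h1, h2⟩
      · exact hq.elim
      · exact ⟨u, (h G _ _).2 ⟨p, q₁, hp, hl.1, h1⟩, (h' G _ _).2 ⟨p₂, q, hl.2, hq, h2⟩⟩
    · exact hp.elim

/-- Adding a state that is initial and final, with empty transitions that make a loop. -/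
def starTr {σ : Type} (tr : σ → Option A → σ → Prop) (s f : σ → Prop) :
    Option σ → Option A → Option σ → Prop
  | some p, a, some q => tr p a q
  | none, a, some q => a = none ∧ s q
  | some p, a, none => a = none ∧ f p
  | none, _, none => False

theorem Recognizes.star {σ : Type} {tr : σ → Option A → σ → Prop} {s f : σ → Prop}
    {r : RegularExpression A} (h : Recognizes tr s f r) :
    Recognizes (starTr tr s f) (· = none) (· = none) (.star r) := by
  intro G v w
  rw [G.reach_star]
  simp only [exists_and_left, exists_eq_left]
  constructor
  · intro hr
    refine ReflTransGen.lift' (r := G.Reach r) (fun v => ((none : Option σ), v)) (fun a b hab => ?_)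
      _ _ hr
    obtain ⟨p, q, hp, hq, hm⟩ := (h G _ _).1 hab
    refine (ReflTransGen.head (b := (some p, a)) (.inl ⟨⟨rfl, hp⟩, rfl⟩) ?_).tail
      (b := (some q, b)) (.inl ⟨⟨rfl, hq⟩, rfl⟩)
    exact ReflTransGen.lift (r := Move G tr) (fun c : σ × G.V => (some c.1, c.2))
      (fun _ _ h => h) _ _ hm
  · intro hm
    -- The run is cut at its visits to `none`: inside `tr`, the vertex `u` of the last visit and the
    -- run since then are remembered.
    suffices H : ∀ c : Option σ × G.V, ReflTransGen (Move G (starTr tr s f)) (none, v) c →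
        (c.1 = none → ReflTransGen (G.Reach r) v c.2) ∧
        (∀ q, c.1 = some q → ∃ u p, ReflTransGen (G.Reach r) v u ∧ s p ∧
          ReflTransGen (Move G tr) (p, u) (q, c.2)) from (H _ hm).1 rfl
    intro c hc
    induction hc with
    | refl => exact ⟨fun _ => .refl, by simp⟩
    | @tail b c _ hm ih =>
      obtain ⟨b1, b2⟩ := b
      obtain ⟨c1, c2⟩ := c
      rcases b1 with _ | b1
      · have ih := ih.1 rfl
        rcases c1 with _ | c1
        · rcases hm with ⟨h1, _⟩ | ⟨_, h1, _⟩ <;> exact h1.elim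
        · rcases hm with ⟨h1, h2⟩ | ⟨_, h1, _⟩
          · obtain rfl : c2 = b2 := h2
            refine ⟨by simp, fun q hq => ⟨c2, c1, ih, h1.2, ?_⟩⟩
            obtain rfl := Option.some.inj hq
            exact .refl
          · exact absurd h1.1 (by simp)
      · obtain ⟨u, p, hu, hp, hpq⟩ := ih.2 b1 rfl
        rcases c1 with _ | c1
        · rcases hm with ⟨h1, h2⟩ | ⟨_, h1, _⟩
          · obtain rfl : c2 = b2 := h2
            exact ⟨fun _ => hu.tail ((h G _ _).2 ⟨p, b1, hp, h1.2, hpq⟩), by simp⟩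
          · exact absurd h1.1 (by simp)
        · refine ⟨by simp, fun q hq => ⟨u, p, hu, hp, ?_⟩⟩
          obtain rfl := Option.some.inj hq
          exact hpq.tail hm

theorem add_le_natPair (a b : ℕ) : a + b ≤ Nat.pair a b := Nat.add_le_pair a b

/-- Every regular expression is recognized by an automaton whose size is bounded in terms of the
Gödel number. -/
theorem exists_recognizes [Encodable A] (r : RegularExpression A) :
    ∃ (σ : Type) (_ : Finite σ) (tr : σ → Option A → σ → Prop) (s f : σ → Prop),
      Nat.card σ ≤ 2 * codeRegex r + 2 ∧ Recognizes tr s f r := by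
  induction r with
  | zero =>
    refine ⟨Unit, inferInstance, fun _ _ _ => False, fun _ => False, fun _ => False, by simp, ?_⟩
    intro G v w
    simpa using G.reach_zero v w
  | epsilon =>
    refine ⟨Unit, inferInstance, fun _ _ _ => False, fun _ => True, fun _ => True, by simp, ?_⟩
    intro G v w
    rw [G.reach_epsilon]
    constructor
    · rintro rfl
      exact ⟨(), (), trivial, trivial, .refl⟩
    · rintro ⟨p, q, -, -, h⟩
      rcases ReflTransGen.cases_head h with h | ⟨c, h, -⟩
      · exact congrArg Prod.snd h
      · rcases h with ⟨h, -⟩ | ⟨_, h, -⟩ <;> exact h.elim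
  | char a =>
    refine ⟨Bool, inferInstance, fun p l q => p = false ∧ l = some a ∧ q = true,
      (· = false), (· = true), by simp, ?_⟩
    intro G v w
    rw [G.reach_char]
    constructor
    · intro h
      exact ⟨false, true, rfl, rfl, .single (.inr ⟨a, ⟨rfl, rfl, rfl⟩, h⟩)⟩
    · rintro ⟨p, q, rfl, rfl, h⟩
      rcases ReflTransGen.cases_head h with h | ⟨⟨c1, c2⟩, h, h'⟩
      · exact absurd (congrArg Prod.fst h) (by simp)
      · rcases h with ⟨h, -⟩ | ⟨b, ⟨-, h, h1⟩, h2⟩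
        · exact absurd h.2.1 (by simp)
        · obtain rfl : c1 = true := h1
          obtain rfl := Option.some.inj h
          rcases ReflTransGen.cases_head h' with h | ⟨c, h, -⟩
          · obtain rfl := congrArg Prod.snd h
            exact h2
          · rcases h with ⟨h, -⟩ | ⟨_, h, -⟩ <;> exact absurd h.1 (by simp)
  | plus r r' ih ih' =>
    obtain ⟨σ, _, tr, s, f, hc, h⟩ := ih
    obtain ⟨τ, _, tr', s', f', hc', h'⟩ := ih'
    refine ⟨σ ⊕ τ, inferInstance, _, _, _, ?_, h.plus h'⟩
    rw [Nat.card_sum, codeRegex]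
    have h1 := add_le_natPair (codeRegex r) (codeRegex r')
    -- The constructor tag in the Gödel number pays for the additive constants of the two bounds.
    have h2 := add_le_natPair 3 (Nat.pair (codeRegex r) (codeRegex r'))
    omega
  | comp r r' ih ih' =>
    obtain ⟨σ, _, tr, s, f, hc, h⟩ := ih
    obtain ⟨τ, _, tr', s', f', hc', h'⟩ := ih'
    refine ⟨σ ⊕ τ, inferInstance, _, _, _, ?_, h.comp h'⟩
    rw [Nat.card_sum, codeRegex]
    have h1 := add_le_natPair (codeRegex r) (codeRegex r')
    have h2 := add_le_natPair 4 (Nat.pair (codeRegex r) (codeRegex r'))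
    omega
  | star r ih =>
    obtain ⟨σ, _, tr, s, f, hc, h⟩ := ih
    refine ⟨Option σ, inferInstance, _, _, _, ?_, h.star⟩
    rw [Finite.card_option, codeRegex]
    have h2 := add_le_natPair 5 (codeRegex r)
    omega

end Automata

end FOReg
namespace FOReg

open Relation

/-! ### Automata running on the counter -/

section CounterAutomata

variable {σ : Type} {tr : σ → Option (Fin 3) → σ → Prop}

/-- The moves of an automaton on the counter, restricted to the levels in `W`. The proposition `z`
tells whether the automaton may use the loop at zero. -/
def CounterMove (tr : σ → Option (Fin 3) → σ → Prop) (z : Prop) (W : ℕ → Prop) (c d : σ × ℕ) :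
    Prop :=
  W c.2 ∧ W d.2 ∧ ((tr c.1 none d.1 ∧ d.2 = c.2) ∨ (tr c.1 (some 0) d.1 ∧ d.2 = c.2 + 1) ∨
    (tr c.1 (some 1) d.1 ∧ c.2 = d.2 + 1) ∨ (z ∧ tr c.1 (some 2) d.1 ∧ c.2 = 0 ∧ d.2 = 0))

/-- All moves except the loop at zero see only the difference of levels, so they can be translated
(`hij`); the loop must again land at zero (`hz`). -/
theorem CounterMove.shift {z z' : Prop} {W W' : ℕ → Prop} {p q : σ} {i j i' j' : ℕ}
    (h : CounterMove tr z W (p, i) (q, j)) (hi : W' i') (hj : W' j') (hij : i + j' = i' + j)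
    (hz : z → i = 0 → j = 0 → z' ∧ i' = 0) : CounterMove tr z' W' (p, i') (q, j') := by
  obtain ⟨-, -, h⟩ := h
  refine ⟨hi, hj, ?_⟩
  simp only at h ⊢
  rcases h with ⟨h, h1⟩ | ⟨h, h1⟩ | ⟨h, h1⟩ | ⟨hz', h, h1, h2⟩
  · exact .inl ⟨h, by omega⟩
  · exact .inr (.inl ⟨h, by omega⟩)
  · exact .inr (.inr (.inl ⟨h, by omega⟩))
  · obtain ⟨h3, h4⟩ := hz hz' h1 h2
    exact .inr (.inr (.inr ⟨h3, h, h4, by omega⟩))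

theorem CounterMove.level {z : Prop} {W : ℕ → Prop} {p q : σ} {i j : ℕ}
    (h : CounterMove tr z W (p, i) (q, j)) : W i ∧ W j ∧ i ≤ j + 1 ∧ j ≤ i + 1 := by
  obtain ⟨h1, h2, h⟩ := h
  refine ⟨h1, h2, ?_⟩
  simp only at h
  omega

theorem CounterMove.tr_inc {z : Prop} {W : ℕ → Prop} {p q : σ} {i : ℕ}
    (h : CounterMove tr z W (p, i) (q, i + 1)) : tr p (some 0) q := by
  obtain ⟨-, -, h⟩ := h
  simp only at h
  rcases h with ⟨h, h1⟩ | ⟨h, h1⟩ | ⟨h, h1⟩ | ⟨_, h, h1, h2⟩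
  · omega
  · exact h
  · omega
  · omega

/-- The state changes of the automaton on paths that start and end at level `n` and do not exceed
this level. -/
def loopsBelow (tr : σ → Option (Fin 3) → σ → Prop) (n : ℕ) (p q : σ) : Prop :=
  ReflTransGen (CounterMove tr True (· ≤ n)) (p, n) (q, n)

/-- A loop below `n + 1` consists of steps on that level and of descents to level `n`, each followed
by a loop below `n` and an ascent. Used in both directions, this shows that `loopsBelow tr n`
determines the next relation. -/
theorem loopsBelow_succ_le {n m : ℕ} (h : loopsBelow tr n ≤ loopsBelow tr m) :
    loopsBelow tr (n + 1) ≤ loopsBelow tr (m + 1) := by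
  intro p q hpq
  have := reflTransGen_excursion (fun c => c.2 = n + 1) hpq rfl rfl
  refine ReflTransGen.lift' (p := CounterMove tr True (· ≤ m + 1))
    (fun c : σ × ℕ => (c.1, m + 1)) ?_ _ _ this
  rintro ⟨a, i⟩ ⟨b, j⟩ ⟨hi, hj, hs⟩
  simp only at hi hj
  subst hi hj
  rcases hs with hs | ⟨⟨c, k⟩, ⟨d, l⟩, hk, hl, h1, h2, h3⟩
  · exact .single (hs.shift le_rfl le_rfl (by omega) (by omega))
  · simp only at hk hl
    have hk' := h1.level
    have hl' := h3.level
    obtain rfl : n = k := by omega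
    obtain rfl : n = l := by omega
    have h2' : loopsBelow tr n c d := by
      refine ReflTransGen.mono ?_ _ _ h2
      rintro ⟨a, i⟩ ⟨b, j⟩ ⟨hi, hj, hs⟩
      have := hs.level
      simp only at hi hj
      exact hs.shift (by omega) (by omega) rfl fun _ h _ => ⟨trivial, h⟩
    have h2'' := ReflTransGen.mono (p := CounterMove tr True (· ≤ m + 1)) (by
      rintro ⟨a, i⟩ ⟨b, j⟩ hs
      have := hs.level
      exact hs.shift (by omega) (by omega) rfl fun _ h _ => ⟨trivial, h⟩) _ _ (h c d h2')
    exact (ReflTransGen.head (h1.shift (by omega) (by omega) (by omega) (by omega)) h2'').tail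
      (h3.shift (by omega) (by omega) (by omega) (by omega))

/-- Reachability for the automaton on the counter. -/
def CounterReach (tr : σ → Option (Fin 3) → σ → Prop) : σ × ℕ → σ × ℕ → Prop :=
  ReflTransGen (CounterMove tr True fun _ => True)

/-- The parts of the path above level `n` are translated; its excursions downwards are loops below
`n`, which `h` replaces by loops below `m`. -/
theorem CounterReach.shift {n m d e : ℕ} {p q : σ} (h : loopsBelow tr n ≤ loopsBelow tr m)
    (hr : CounterReach tr (p, n + 1 + d) (q, n + 1 + e)) :
    CounterReach tr (p, m + 1 + d) (q, m + 1 + e) := by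
  have := reflTransGen_excursion (fun c => n + 1 ≤ c.2) hr (by simp only; omega)
    (by simp only; omega)
  have := ReflTransGen.lift' (p := CounterMove tr True fun _ => True)
    (fun c : σ × ℕ => (c.1, c.2 - n + m)) ?_ _ _ this
  · simp only [Function.onFun] at this
    rw [show n + 1 + d - n + m = m + 1 + d by omega,
      show n + 1 + e - n + m = m + 1 + e by omega] at this
    exact this
  rintro ⟨a, i⟩ ⟨b, j⟩ ⟨hi, hj, hs⟩
  simp only at hi hj
  rcases hs with hs | ⟨⟨c, k⟩, ⟨d, l⟩, hk, hl, h1, h2, h3⟩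
  · exact .single (hs.shift trivial trivial (by omega) (by omega))
  · simp only at hk hl
    have hk' := h1.level
    have hl' := h3.level
    obtain rfl : n = k := by omega
    obtain rfl : n = l := by omega
    have h2' : loopsBelow tr n c d := by
      refine ReflTransGen.mono ?_ _ _ h2
      rintro ⟨a, i⟩ ⟨b, j⟩ ⟨hi, hj, hs⟩
      have := hs.level
      simp only at hi hj
      exact hs.shift (by omega) (by omega) rfl fun _ h _ => ⟨trivial, h⟩
    have h2'' := ReflTransGen.mono (p := CounterMove tr True fun _ => True) (by
      rintro ⟨a, i⟩ ⟨b, j⟩ hs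
      exact hs.shift trivial trivial rfl fun _ h _ => ⟨trivial, h⟩) _ _ (h c d h2')
    exact (ReflTransGen.head (h1.shift trivial trivial (by omega) (by omega)) h2'').tail
      (h3.shift trivial trivial (by omega) (by omega))

/-- The state changes of the automaton, without the loop at zero, on paths from level `0` to
level `d`. -/
def climbs (tr : σ → Option (Fin 3) → σ → Prop) (d : ℕ) (p q : σ) : Prop :=
  ReflTransGen (CounterMove tr False fun _ => True) (p, 0) (q, d)

/-- Cut the path at its last exit from the levels up to `i`: a climb to `i`, one increment, and a
rest above `i` that can be translated. -/
theorem climbs_succ_le {i j : ℕ} (h : climbs tr i ≤ climbs tr j) :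
    climbs tr (i + 1) ≤ climbs tr (j + 1) := by
  intro p q hpq
  obtain ⟨⟨a, k⟩, ⟨c, l⟩, ha, hc, h1, h2, h3⟩ := reflTransGen_last_exit (fun c => c.2 ≤ i) hpq
    (Nat.zero_le _) (by simp)
  simp only at ha hc
  have h2' := h2.level
  obtain rfl : i = k := by omega
  obtain rfl : l = i + 1 := by omega
  have h4 := (h p a h1).tail (h2.shift (j' := j + 1) trivial trivial (by omega) (by tauto))
  have h5 := ReflTransGen.lift (p := CounterMove tr False fun _ => True)
    (fun c : σ × ℕ => (c.1, c.2 - i + j)) ?_ _ _ h3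
  · simp only [Function.onFun] at h5
    rw [show i + 1 - i + j = j + 1 by omega] at h5
    exact h4.trans h5
  rintro ⟨a, i⟩ ⟨b, j⟩ ⟨hi, hj, hs⟩
  simp only at hi hj
  exact hs.shift trivial trivial (by omega) (by tauto)

/-- Cutting at the last exit from the levels up to `x` decouples the two parameters: the first part
depends only on `x`, and the second, never meeting zero, only on `d`. -/
theorem counterReach_add_iff {x d : ℕ} {p q : σ} : CounterReach tr (p, x) (q, x + 1 + d) ↔
    ∃ p₁ q₁, CounterReach tr (p, x) (p₁, x) ∧ tr p₁ (some 0) q₁ ∧ climbs tr d q₁ q := by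
  constructor
  · intro h
    obtain ⟨⟨a, k⟩, ⟨c, l⟩, ha, hc, h1, h2, h3⟩ := reflTransGen_last_exit (fun c => c.2 ≤ x) h
      le_rfl (by simp only; omega)
    simp only at ha hc
    have h2' := h2.level
    obtain rfl : x = k := by omega
    obtain rfl : l = x + 1 := by omega
    refine ⟨a, c, h1, h2.tr_inc, ?_⟩
    have h4 := ReflTransGen.lift (p := CounterMove tr False fun _ => True)
      (fun c : σ × ℕ => (c.1, c.2 - (x + 1))) ?_ _ _ h3
    · simp only [Function.onFun] at h4
      rw [Nat.sub_self, Nat.add_sub_cancel_left] at h4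
      exact h4
    rintro ⟨a, i⟩ ⟨b, j⟩ ⟨hi, hj, hs⟩
    simp only at hi hj
    exact hs.shift trivial trivial (by omega) (by omega)
  · rintro ⟨p₁, q₁, h1, h2, h3⟩
    have h4 := ReflTransGen.lift (p := CounterMove tr True fun _ => True)
      (fun c : σ × ℕ => (c.1, c.2 + (x + 1))) ?_ _ _ h3
    · simp only [Function.onFun] at h4
      rw [zero_add, add_comm d] at h4
      exact (h1.tail ⟨trivial, trivial, .inr (.inl ⟨h2, rfl⟩)⟩).trans h4
    rintro ⟨a, i⟩ ⟨b, j⟩ hs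
    exact hs.shift trivial trivial (by omega) (by tauto)

/-- The state changes of the automaton, without the loop at zero, on paths from level `0` to
level `0` that do not exceed the level `j`. -/
def loopsAbove (tr : σ → Option (Fin 3) → σ → Prop) (j : ℕ) (p q : σ) : Prop :=
  ReflTransGen (CounterMove tr False (· ≤ j)) (p, 0) (q, 0)

theorem loopsAbove_mono : Monotone (loopsAbove tr) := by
  intro i j hij p q h
  refine ReflTransGen.mono ?_ _ _ h
  rintro ⟨a, k⟩ ⟨b, l⟩ hs
  have := hs.level
  exact hs.shift (by omega) (by omega) rfl (by tauto)

/-- The mirror image of `loopsBelow_succ_le`, with excursions to level `1` and above. -/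
theorem loopsAbove_succ_le {i j : ℕ} (h : loopsAbove tr i ≤ loopsAbove tr j) :
    loopsAbove tr (i + 1) ≤ loopsAbove tr (j + 1) := by
  intro p q hpq
  have := reflTransGen_excursion (fun c => c.2 = 0) hpq rfl rfl
  refine ReflTransGen.lift' (p := CounterMove tr False (· ≤ j + 1))
    (fun c : σ × ℕ => (c.1, 0)) ?_ _ _ this
  rintro ⟨a, k⟩ ⟨b, l⟩ ⟨hk, hl, hs⟩
  simp only at hk hl
  subst hk hl
  rcases hs with hs | ⟨⟨c, k⟩, ⟨d, l⟩, hk, hl, h1, h2, h3⟩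
  · exact .single (hs.shift (by omega) (by omega) rfl (by tauto))
  · simp only at hk hl
    have hk' := h1.level
    have hl' := h3.level
    obtain rfl : k = 1 := by omega
    obtain rfl : l = 1 := by omega
    have h2' : loopsAbove tr i c d := by
      refine ReflTransGen.lift (p := CounterMove tr False (· ≤ i))
        (fun c : σ × ℕ => (c.1, c.2 - 1)) ?_ _ _ h2
      rintro ⟨a, k⟩ ⟨b, l⟩ ⟨hk, hl, hs⟩
      have := hs.level
      simp only at hk hl
      exact hs.shift (by omega) (by omega) (by omega) (by tauto)
    have h2'' := ReflTransGen.lift (p := CounterMove tr False (· ≤ j + 1))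
      (fun c : σ × ℕ => (c.1, c.2 + 1)) (by
      rintro ⟨a, k⟩ ⟨b, l⟩ hs
      have := hs.level
      exact hs.shift (by omega) (by omega) (by omega) (by tauto)) _ _ (h c d h2')
    exact (ReflTransGen.head (h1.shift (by omega) (by omega) (by omega) (by tauto)) h2'').tail
      (h3.shift (by omega) (by omega) (by omega) (by tauto))

theorem exists_loopsAbove {p q : σ} (h : climbs tr 0 p q) : ∃ j, loopsAbove tr j p q := by
  suffices H : ∀ c d : σ × ℕ, ReflTransGen (CounterMove tr False fun _ => True) c d →
      ∃ j, ReflTransGen (CounterMove tr False (· ≤ j)) c d from H _ _ h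
  intro c d h
  induction h with
  | refl => exact ⟨0, .refl⟩
  | @tail b d _ hs ih =>
    obtain ⟨j, hj⟩ := ih
    obtain ⟨b, k⟩ := b
    obtain ⟨d, l⟩ := d
    refine ⟨max j (max k l), (ReflTransGen.mono ?_ _ _ hj).tail
      (hs.shift (by omega) (by omega) rfl (by tauto))⟩
    rintro ⟨a, k⟩ ⟨b, l⟩ hs
    have := hs.level
    exact hs.shift (by omega) (by omega) rfl (by tauto)

section Bounds

variable [Finite σ] {T : ℕ}

/-- Paths on the counter can be confined to levels not far above their ends. -/
theorem counterReach_iff_bounded (hT : Nat.card (σ → σ → Prop) ≤ T) {x y b B : ℕ} {p q : σ} (hx : x ≤ b) (hy : y ≤ b)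
    (hB : b + 1 + T ≤ B) : CounterReach tr (p, x) (q, y) ↔
      ReflTransGen (CounterMove tr True (· ≤ B)) (p, x) (q, y) := by
  constructor
  · intro h
    have := reflTransGen_excursion (fun c => c.2 ≤ b) h hx hy
    refine ReflTransGen.lift' (p := CounterMove tr True (· ≤ B)) id ?_ _ _ this
    rintro ⟨a, i⟩ ⟨a', j⟩ ⟨hi, hj, hs⟩
    simp only at hi hj
    rcases hs with hs | ⟨⟨c, k⟩, ⟨d, l⟩, hk, hl, h1, h2, h3⟩
    · exact .single (hs.shift (by omega) (by omega) (by omega) (by tauto))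
    · simp only at hk hl
      have hk' := h1.level
      have hl' := h3.level
      obtain rfl : b = i := by omega
      obtain rfl : b = j := by omega
      obtain rfl : k = b + 1 := by omega
      obtain rfl : l = b + 1 := by omega
      have h4 := ReflTransGen.lift (p := CounterMove tr False fun _ => True)
        (fun c : σ × ℕ => (c.1, c.2 - (b + 1))) (by
          rintro ⟨a, i⟩ ⟨b, j⟩ ⟨hi, hj, hs⟩
          simp only at hi hj
          exact hs.shift trivial trivial (by omega) (by omega)) _ _ h2
      simp only [Function.onFun, Nat.sub_self] at h4
      obtain ⟨n, hn⟩ := exists_loopsAbove h4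
      -- However high the excursion above `b` goes, the same state change is possible within `T`
      -- further levels, because `loopsAbove` increases and stabilises.
      have h5 := seq_le_of_monotone (s := loopsAbove tr)
        (fun i j h => le_antisymm (loopsAbove_succ_le h.le) (loopsAbove_succ_le h.ge)) hT
        loopsAbove_mono n c d hn
      have h6 := ReflTransGen.lift (p := CounterMove tr True (· ≤ B))
        (fun c : σ × ℕ => (c.1, c.2 + (b + 1))) (by
          rintro ⟨a, i⟩ ⟨b, j⟩ hs
          have := hs.level
          exact hs.shift (by omega) (by omega) (by omega) (by tauto)) _ _ h5
      simp only [Function.onFun, zero_add] at h6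
      exact (ReflTransGen.head (h1.shift (by omega) (by omega) (by omega) (by tauto)) h6).tail
        (h3.shift (by omega) (by omega) (by omega) (by tauto))
  · intro h
    refine ReflTransGen.mono ?_ _ _ h
    rintro ⟨a, k⟩ ⟨b, l⟩ hs
    exact hs.shift trivial trivial rfl (by tauto)

/-- The levels below `x = n + 1` matter only through `loopsBelow tr n`, which is periodic for `n ≥
T`; hence the threshold `T + 1`. -/
theorem counterReach_add_congr (hT : Nat.card (σ → σ → Prop) ≤ T) {x x' e : ℕ} {p q : σ}
    (hx : x = x' ∨ T + 1 ≤ x ∧ T + 1 ≤ x' ∧ x ≡ x' [MOD T.factorial]) :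
    CounterReach tr (p, x) (q, x + e) ↔ CounterReach tr (p, x') (q, x' + e) := by
  rcases hx with rfl | ⟨h1, h2, h3⟩
  · rfl
  · obtain ⟨n, rfl⟩ := Nat.exists_eq_add_of_le' (show 1 ≤ x by omega)
    obtain ⟨m, rfl⟩ := Nat.exists_eq_add_of_le' (show 1 ≤ x' by omega)
    have h : loopsBelow tr n = loopsBelow tr m :=
      seq_eq_of_modEq (s := loopsBelow tr)
        (fun i j h => le_antisymm (loopsBelow_succ_le h.le) (loopsBelow_succ_le h.ge)) hT
        (by omega) (by omega) (Nat.ModEq.add_right_cancel' 1 h3)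
    exact ⟨fun hr => CounterReach.shift (d := 0) h.le hr,
      fun hr => CounterReach.shift (d := 0) h.ge hr⟩

theorem counterReach_add_congr' (hT : Nat.card (σ → σ → Prop) ≤ T) {x x' e e' : ℕ} {p q : σ}
    (hx : x = x' ∨ T + 1 ≤ x ∧ T + 1 ≤ x' ∧ x ≡ x' [MOD T.factorial])
    (he : e = e' ∨ T + 1 ≤ e ∧ T + 1 ≤ e' ∧ e ≡ e' [MOD T.factorial]) :
    CounterReach tr (p, x) (q, x + e) ↔ CounterReach tr (p, x') (q, x' + e') := by
  rcases he with rfl | ⟨h1, h2, h3⟩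
  · exact counterReach_add_congr hT hx
  · obtain ⟨n, rfl⟩ := Nat.exists_eq_add_of_le (show 1 ≤ e by omega)
    obtain ⟨m, rfl⟩ := Nat.exists_eq_add_of_le (show 1 ≤ e' by omega)
    have h : climbs tr n = climbs tr m :=
      seq_eq_of_modEq (s := climbs tr)
        (fun i j h => le_antisymm (climbs_succ_le h.le) (climbs_succ_le h.ge)) hT
        (by omega) (by omega) (Nat.ModEq.add_left_cancel' 1 h3)
    rw [← add_assoc, ← add_assoc, counterReach_add_iff, counterReach_add_iff, h]
    -- After the cut only the loops at level `x` are left to compare, which is the case `e = 0`.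
    have := fun p q => counterReach_add_congr (tr := tr) (p := p) (q := q) (e := 0) hT hx
    simp only [add_zero] at this
    simp only [this]

end Bounds

/-- The automaton that traverses the paths backwards. -/
def reverseTr (tr : σ → Option (Fin 3) → σ → Prop) (p : σ) (a : Option (Fin 3)) (q : σ) : Prop :=
  tr q (a.map (Equiv.swap 0 1)) p

/-- Reversal exchanges increments with decrements and keeps the loop at zero. It reduces descending
paths to ascending ones. -/
theorem counterReach_reverseTr (c d : σ × ℕ) :
    CounterReach (reverseTr tr) c d ↔ CounterReach tr d c := by
  unfold CounterReach
  rw [← reflTransGen_swap]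
  suffices h : CounterMove (reverseTr tr) True (fun _ => True) =
      Function.swap (CounterMove tr True fun _ => True) by rw [h]
  funext c d
  have h2 : (Equiv.swap 0 1 : Equiv.Perm (Fin 3)) 2 = 2 := rfl
  simp only [CounterMove, reverseTr, Function.swap, Option.map_none, Option.map_some,
    Equiv.swap_apply_left, Equiv.swap_apply_right, true_and, eq_iff_iff, h2]
  rw [eq_comm (a := d.2) (b := c.2)]
  tauto

/-- Two integers are similar if they are equal, or congruent and both large with the same sign. -/
def Similar (D M : ℕ) (a b : ℤ) : Prop :=
  a = b ∨ a ≡ b [ZMOD M] ∧ ((D ≤ a ∧ D ≤ b) ∨ (a ≤ -D ∧ b ≤ -D))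

theorem Similar.natCast {D M x y : ℕ} (hD : 0 < D) (h : Similar D M x y) :
    x = y ∨ D ≤ x ∧ D ≤ y ∧ x ≡ y [MOD M] := by
  rcases h with h | ⟨h, ⟨h1, h2⟩ | ⟨h1, h2⟩⟩
  · exact .inl (by exact_mod_cast h)
  · exact .inr ⟨by exact_mod_cast h1, by exact_mod_cast h2, Int.natCast_modEq_iff.1 h⟩
  · omega

theorem Similar.neg {D M : ℕ} {a b : ℤ} (h : Similar D M a b) : Similar D M (-a) (-b) := by
  rcases h with h | ⟨h, h'⟩
  · exact .inl (by rw [h])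
  · exact .inr ⟨h.neg, by omega⟩

/-- Reachability on the counter only depends on the similarity classes of the two numbers and
their difference. -/
theorem counterReach_congr [Finite σ] {T : ℕ} (hT : Nat.card (σ → σ → Prop) ≤ T) {x x' y y' : ℕ}
    {p q : σ} (hx : Similar (T + 1) T.factorial x x') (hy : Similar (T + 1) T.factorial y y')
    (hxy : Similar (T + 1) T.factorial (y - x) (y' - x')) :
    CounterReach tr (p, x) (q, y) ↔ CounterReach tr (p, x') (q, y') := by
  wlog h : x ≤ y generalizing tr x x' y y' p q
  · rw [← counterReach_reverseTr (q, y) (p, x), ← counterReach_reverseTr (q, y') (p, x')]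
    refine this hy hx ?_ (by omega)
    simpa using hxy.neg
  have h' : x' ≤ y' := by
    rcases hxy with h | ⟨_, h⟩ <;> omega
  obtain ⟨e, rfl⟩ := Nat.exists_eq_add_of_le h
  obtain ⟨e', rfl⟩ := Nat.exists_eq_add_of_le h'
  push_cast at hxy
  rw [add_sub_cancel_left, add_sub_cancel_left] at hxy
  exact counterReach_add_congr' hT (hx.natCast (by omega)) (hxy.natCast (by omega))

end CounterAutomata

/-- The restriction of the counter to the numbers up to `B`. -/
def boundedCounter (B : ℕ) : TransitionSystem (Fin 3) where
  V := ℕ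
  E a v w := v ≤ B ∧ w ≤ B ∧ counter.E a v w

/-- Reachability in the counter as a relation between numbers. -/
abbrev counterReach (r : RegularExpression (Fin 3)) (v w : ℕ) : Prop := counter.Reach r v w

/-- Reachability in the bounded counter as a relation between numbers. -/
abbrev boundedReach (B : ℕ) (r : RegularExpression (Fin 3)) (v w : ℕ) : Prop :=
  (boundedCounter B).Reach r v w

theorem move_counter {σ : Type} (tr : σ → Option (Fin 3) → σ → Prop) :
    Move counter tr = CounterMove tr True fun _ => True := by
  funext c d
  simp only [Move, CounterMove, true_and, Fin.exists_fin_succ, eq_iff_iff]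
  simp [counter]

/-- The bounded counter still has vertices above `B`, where empty moves are possible; starting at `x
≤ B` excludes them. -/
theorem reflTransGen_move_boundedCounter {σ : Type} (tr : σ → Option (Fin 3) → σ → Prop) {B x : ℕ}
    (hx : x ≤ B) (p q : σ) (y : ℕ) : ReflTransGen (Move (boundedCounter B) tr) (p, x) (q, y) ↔
      ReflTransGen (CounterMove tr True (· ≤ B)) (p, x) (q, y) := by
  have key : ∀ c d : σ × ℕ, c.2 ≤ B →
      (Move (boundedCounter B) tr c d ↔ CounterMove tr True (· ≤ B) c d) := by
    intro c d hc
    simp only [Move, CounterMove, true_and, Fin.exists_fin_succ, hc]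
    simp [counter, boundedCounter, hc]
    have : d.2 = c.2 → d.2 ≤ B := by omega
    tauto
  have hle : ∀ c d : σ × ℕ, CounterMove tr True (· ≤ B) c d → d.2 ≤ B := fun c d h => h.2.1
  constructor
  · intro h
    suffices H : ∀ d : σ × ℕ, ReflTransGen (Move (boundedCounter B) tr) (p, x) d →
        d.2 ≤ B ∧ ReflTransGen (CounterMove tr True (· ≤ B)) (p, x) d from (H _ h).2
    intro d h
    induction h with
    | refl => exact ⟨hx, .refl⟩
    | tail _ h ih =>
      have := (key _ _ ih.1).1 h
      exact ⟨hle _ _ this, ih.2.tail this⟩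
  · intro h
    exact ReflTransGen.mono (fun c d h => (key _ _ h.1).2 h) _ _ h

theorem card_relations_le {σ : Type} [Finite σ] {K : ℕ} (hK : Nat.card σ ≤ K) :
    Nat.card (σ → σ → Prop) ≤ 2 ^ (K * K) := by
  rw [Nat.card_fun, Nat.card_fun, ← pow_mul]
  rw [show Nat.card Prop = 2 by simp]
  exact Nat.pow_le_pow_right two_pos (Nat.mul_le_mul hK hK)

variable {r : RegularExpression (Fin 3)} {K : ℕ}

/-- The automaton has at most `K` states, so `2 ^ (K * K)` bounds the number of relations on them.
Threshold and period thus depend on `K` alone, and no automaton has to be computed. -/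
theorem counterReach_regex_congr (hr : 2 * codeRegex r + 2 ≤ K) {x x' y y' : ℕ}
    (hx : Similar (2 ^ (K * K) + 1) (2 ^ (K * K)).factorial x x')
    (hy : Similar (2 ^ (K * K) + 1) (2 ^ (K * K)).factorial y y')
    (hxy : Similar (2 ^ (K * K) + 1) (2 ^ (K * K)).factorial (y - x) (y' - x')) :
    counterReach r x y ↔ counterReach r x' y' := by
  obtain ⟨σ, _, tr, s, f, hc, h⟩ := exists_recognizes r
  refine (h counter x y).trans (Iff.trans ?_ (h counter x' y').symm)
  rw [move_counter]
  exact exists_congr fun p => exists_congr fun q => and_congr_right fun _ => and_congr_right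
    fun _ => counterReach_congr (card_relations_le (hc.trans hr)) hx hy hxy

theorem counterReach_iff_boundedReach (hr : 2 * codeRegex r + 2 ≤ K) {x y b B : ℕ} (hx : x ≤ b)
    (hy : y ≤ b) (hB : b + 1 + 2 ^ (K * K) ≤ B) : counterReach r x y ↔ boundedReach B r x y := by
  obtain ⟨σ, _, tr, s, f, hc, h⟩ := exists_recognizes r
  refine (h counter x y).trans (Iff.trans ?_ (h (boundedCounter B) x y).symm)
  rw [move_counter]
  refine exists_congr fun p => exists_congr fun q => and_congr_right fun _ => and_congr_right
    fun _ => ?_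
  exact (counterReach_iff_bounded (card_relations_le (hc.trans hr)) hx hy hB).trans
    (reflTransGen_move_boundedCounter tr (hx.trans ((Nat.le_add_right b _).trans
      (by rwa [add_assoc] at hB))) p q y).symm

end FOReg
namespace FOReg

open FirstOrder

/-! ### Similarity and back-and-forth -/

section Similarity

variable {D M : ℕ}

theorem Similar.refl (a : ℤ) : Similar D M a a := .inl rfl

theorem Similar.weaken {D' : ℕ} {a b : ℤ} (h : Similar D M a b) (hD : D' ≤ D) :
    Similar D' M a b := by
  rcases h with h | ⟨h, h'⟩
  · exact .inl h
  · exact .inr ⟨h, by omega⟩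

/-- The back-and-forth property of similarity. -/
theorem exists_similar {ι : Type*} [Finite ι] [Nonempty ι] (hD : 0 < D) (hM : 0 < M) {a b : ι → ℤ}
    (h : ∀ i j, Similar (2 * D + 2 * M) M (a i - a j) (b i - b j)) {x : ℤ} (hx : ∃ i, a i ≤ x) :
    ∃ y, (∀ i, Similar D M (x - a i) (y - b i)) ∧ ∃ i, y ≤ b i + D + M := by
  -- If `x` is near some `a i`, the same offset from `b i` works. Otherwise only the residue of `x`
  -- and its place in the order matter.
  by_cases hnear : ∃ i, -(D + M : ℤ) ≤ x - a i ∧ x - a i ≤ D + M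
  · obtain ⟨i, h1, h2⟩ := hnear
    refine ⟨b i + (x - a i), fun j => ?_, i, by omega⟩
    rcases h i j with h | ⟨h, h' | h'⟩
    · exact .inl (by omega)
    · refine .inr ⟨?_, .inl (by push_cast at h'; omega)⟩
      convert! h.add_right (x - a i) using 1 <;> ring
    · refine .inr ⟨?_, .inr (by push_cast at h'; omega)⟩
      convert! h.add_right (x - a i) using 1 <;> ring
  · have := Fintype.ofFinite ι
    obtain ⟨i₀, hi₀⟩ := hx
    obtain ⟨i, hi, hmax⟩ := Finset.exists_max_image (Finset.univ.filter fun i => a i ≤ x) a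
      ⟨i₀, by simpa using hi₀⟩
    simp only [Finset.mem_filter, Finset.mem_univ, true_and] at hi hmax
    have hfar : ∀ j, x - a j < -(D + M : ℤ) ∨ (D + M : ℤ) < x - a j := by
      intro j
      by_contra hj
      exact hnear ⟨j, by omega, by omega⟩
    have hM' : (0 : ℤ) < M := by exact_mod_cast hM
    have hm1 := Int.emod_nonneg (x - a i - D) hM'.ne'
    have hm2 := Int.emod_lt_of_pos (x - a i - D) hM'
    have hi' := hfar i
    have hmod : x - a i ≡ D + (x - a i - D) % M [ZMOD M] := by
      have := (Int.mod_modEq (x - a i - D) M).symm.add_left (D : ℤ)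
      rwa [add_sub_cancel] at this
    set m := (x - a i - D) % M with hm
    clear_value m
    -- Here `a i` is the largest member up to `x`, and `m < M` corrects the residue. A member above
    -- `x` exceeds `a i` by more than `2 * D + 2 * M`, so its counterpart stays at least `D` above
    -- the chosen point.
    refine ⟨b i + (D + m), fun j => .inr ⟨?_, ?_⟩, i, by omega⟩
    · have hij : a i - a j ≡ b i - b j [ZMOD M] := by
        rcases h i j with h | ⟨h, -⟩
        · rw [h]
        · exact h
      convert! hmod.add hij using 1 <;> ring
    · have hij := h i j
      have hj := hfar j
      by_cases hjx : a j ≤ x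
      · have := hmax j hjx
        left
        rcases hij with h | ⟨_, h | h⟩ <;> push_cast at * <;> omega
      · right
        rcases hij with h | ⟨_, h | h⟩ <;> push_cast at * <;> omega

/-- Two tuples of numbers are similar if corresponding members and their differences are. -/
def TupleSimilar {n : ℕ} (D M : ℕ) (a b : Fin n → ℕ) : Prop :=
  (∀ i, Similar D M (a i) (b i)) ∧ ∀ i j, Similar D M (a i - a j) (b i - b j)

theorem TupleSimilar.refl {n : ℕ} (a : Fin n → ℕ) : TupleSimilar D M a a :=
  ⟨fun _ => .refl _, fun _ _ => .refl _⟩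

theorem TupleSimilar.symm {n : ℕ} {a b : Fin n → ℕ} (h : TupleSimilar D M a b) :
    TupleSimilar D M b a := by
  have : ∀ {x y : ℤ}, Similar D M x y → Similar D M y x := by
    rintro x y (h | ⟨h, h'⟩)
    · exact .inl h.symm
    · exact .inr ⟨h.symm, by tauto⟩
  exact ⟨fun i => this (h.1 i), fun i j => this (h.2 i j)⟩

theorem TupleSimilar.weaken {n D' : ℕ} {a b : Fin n → ℕ} (h : TupleSimilar D M a b)
    (hD : D' ≤ D) : TupleSimilar D' M a b :=
  ⟨fun i => (h.1 i).weaken hD, fun i j => (h.2 i j).weaken hD⟩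

/-- Adding `0` as a further member turns values into differences, so `exists_similar` handles both
at once. The bound on `y` is what later makes quantifiers finite. -/
theorem TupleSimilar.exists_snoc {n : ℕ} (hD : 0 < D) (hM : 0 < M) {a b : Fin n → ℕ}
    (h : TupleSimilar (2 * D + 2 * M) M a b) (x : ℕ) :
    ∃ y : ℕ, TupleSimilar D M (Fin.snoc a x : Fin (n + 1) → ℕ) (Fin.snoc b y : Fin (n + 1) → ℕ) ∧
      (y ≤ D + M ∨ ∃ i, y ≤ b i + D + M) := by
  let ext : (Fin n → ℕ) → Option (Fin n) → ℤ := fun a i => i.elim 0 fun i => a i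
  have hext : ∀ i j, Similar (2 * D + 2 * M) M (ext a i - ext a j) (ext b i - ext b j) := by
    rintro (_ | i) (_ | j)
    · exact .inl rfl
    · simpa [ext] using (h.1 j).neg
    · simpa [ext] using h.1 i
    · exact h.2 i j
  obtain ⟨y, hy, i, hi⟩ := exists_similar hD hM hext (x := x) ⟨none, by simp [ext]⟩
  have hy0 : Similar D M x y := by simpa [ext] using hy none
  have hypos : 0 ≤ y := by
    rcases hy0 with h | ⟨_, h | h⟩ <;> omega
  lift y to ℕ using hypos
  refine ⟨y, ⟨?_, ?_⟩, ?_⟩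
  · refine Fin.lastCases ?_ fun i => ?_
    · simpa using hy0
    · simpa using (h.1 i).weaken (by omega)
  · have hyi : ∀ i, Similar D M ((x : ℤ) - a i) (y - b i) := fun i => hy (some i)
    refine Fin.lastCases ?_ fun i => ?_ <;> refine Fin.lastCases ?_ fun j => ?_
    · simpa using Similar.refl (D := D) (M := M) 0
    · simpa using hyi j
    · simpa using (hyi i).neg
    · simpa using (h.2 i j).weaken (by omega)
  · rcases i with _ | i
    · left
      simp only [ext, Option.elim_none, zero_add] at hi
      omega
    · right
      simp only [ext, Option.elim_some] at hi
      exact ⟨i, by omega⟩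

end Similarity

/-! ### Invariance of truth and bounded quantifiers -/

/-- Truth of formulas in the counter. -/
def Holds {n : ℕ} (φ : (lang (Fin 3)).BoundedFormula Empty n) (xs : Fin n → ℕ) : Prop :=
  letI := counter.toStructure
  Language.BoundedFormula.Realize (M := counter.V) φ default xs

theorem exists_eq_var {A : Type} {n : ℕ} (t : (lang A).Term (Empty ⊕ Fin n)) :
    ∃ i, t = .var (.inr i) := by
  rcases t with ⟨i | i⟩ | ⟨f, _⟩
  · exact i.elim
  · exact ⟨i, rfl⟩
  · exact nomatch f

section Holds

variable {n : ℕ} (xs : Fin n → ℕ)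

theorem not_holds_falsum : ¬ Holds .falsum xs := id

theorem holds_equal (i j : Fin n) :
    Holds (.equal (.var (.inr i)) (.var (.inr j))) xs ↔ xs i = xs j := Iff.rfl

theorem holds_edge (a : Fin 3) (i j : Fin n)
    {ts : Fin 2 → (lang (Fin 3)).Term (Empty ⊕ Fin n)} (hi : ts 0 = .var (.inr i))
    (hj : ts 1 = .var (.inr j)) :
    Holds (.rel (.edge a : (lang (Fin 3)).Relations 2) ts) xs ↔ counter.E a (xs i) (xs j) := by
  let := counter.toStructure
  change counter.E a (Language.Term.realize _ (ts 0)) (Language.Term.realize _ (ts 1)) ↔ _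
  rw [hi, hj]
  rfl

theorem holds_reach (r : RegularExpression (Fin 3)) (i j : Fin n)
    {ts : Fin 2 → (lang (Fin 3)).Term (Empty ⊕ Fin n)} (hi : ts 0 = .var (.inr i))
    (hj : ts 1 = .var (.inr j)) :
    Holds (.rel (.reach r : (lang (Fin 3)).Relations 2) ts) xs ↔ counterReach r (xs i) (xs j) := by
  let := counter.toStructure
  change counter.Reach r (Language.Term.realize _ (ts 0)) (Language.Term.realize _ (ts 1)) ↔ _
  rw [hi, hj]
  rfl

theorem holds_imp (φ ψ : (lang (Fin 3)).BoundedFormula Empty n) :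
    Holds (.imp φ ψ) xs ↔ (Holds φ xs → Holds ψ xs) := Iff.rfl

theorem holds_all (φ : (lang (Fin 3)).BoundedFormula Empty (n + 1)) :
    Holds (.all φ) xs ↔ ∀ x : ℕ, Holds φ (Fin.snoc xs x : Fin (n + 1) → ℕ) := Iff.rfl

end Holds

/-- The period for the evaluation of formulas with Gödel number at most `N`. -/
def period (N : ℕ) : ℕ := (2 ^ ((2 * N + 2) * (2 * N + 2))).factorial

/-- The threshold for the evaluation of formulas with Gödel number at most `N`. -/
def threshold (N : ℕ) : ℕ := 2 ^ ((2 * N + 2) * (2 * N + 2)) + 1 + period N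

theorem period_pos (N : ℕ) : 0 < period N := Nat.factorial_pos _

/-- A quantifier raises the threshold from `D` to `2 * D + 2 * M`, at most `4 * D` as `M ≤ D`. The
Gödel number serves in place of the quantifier rank. -/
theorem two_mul_add_le {N c d : ℕ} (h : c < d) :
    2 * (4 ^ c * threshold N) + 2 * period N ≤ 4 ^ d * threshold N := by
  have h1 : 4 * 4 ^ c ≤ 4 ^ d := by
    rw [← pow_succ']
    exact Nat.pow_le_pow_right (by omega) h
  have h2 : period N ≤ 4 ^ c * threshold N := by
    calc period N ≤ 1 * threshold N := by rw [one_mul]; exact Nat.le_add_left _ _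
      _ ≤ _ := Nat.mul_le_mul_right _ (Nat.one_le_pow _ _ (by omega))
  calc _ ≤ 4 * 4 ^ c * threshold N := by rw [mul_assoc]; omega
    _ ≤ _ := Nat.mul_le_mul_right _ h1

theorem le_pow_mul_threshold (N c : ℕ) :
    2 ^ ((2 * N + 2) * (2 * N + 2)) + 1 ≤ 4 ^ c * threshold N := by
  calc _ ≤ 1 * threshold N := by rw [one_mul]; exact Nat.le_add_right _ _
    _ ≤ _ := Nat.mul_le_mul_right _ (Nat.one_le_pow _ _ (by omega))

theorem one_lt_pow_mul_threshold (N c : ℕ) : 1 < 4 ^ c * threshold N :=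
  lt_of_lt_of_le (Nat.lt_add_of_pos_left (by positivity)) (le_pow_mul_threshold N c)

theorem counterReach_congr_of_tupleSimilar {n N c : ℕ} {r : RegularExpression (Fin 3)}
    (hr : codeRegex r ≤ N) {a b : Fin n → ℕ}
    (h : TupleSimilar (4 ^ c * threshold N) (period N) a b) (i j : Fin n) :
    counterReach r (a i) (a j) ↔ counterReach r (b i) (b j) := by
  have h' := h.weaken (le_pow_mul_threshold N c)
  exact counterReach_regex_congr (K := 2 * N + 2) (by omega) (h'.1 i) (h'.1 j) (h'.2 j i)

/-- Truth in the counter is invariant under similarity. -/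
theorem holds_congr {n N : ℕ} (φ : (lang (Fin 3)).BoundedFormula Empty n) (hφ : codeFormula φ ≤ N)
    {a b : Fin n → ℕ} (h : TupleSimilar (4 ^ codeFormula φ * threshold N) (period N) a b) :
    Holds φ a ↔ Holds φ b := by
  induction φ with
  | falsum => exact Iff.rfl
  | equal s t =>
    obtain ⟨i, rfl⟩ := exists_eq_var s
    obtain ⟨j, rfl⟩ := exists_eq_var t
    rw [holds_equal, holds_equal]
    rcases (h.weaken (one_lt_pow_mul_threshold N _).le).2 i j with h | ⟨_, h⟩ <;>
      push_cast at h <;> omega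
  | rel R ts =>
    cases R with
    | edge e =>
      obtain ⟨i, hi⟩ := exists_eq_var (ts 0)
      obtain ⟨j, hj⟩ := exists_eq_var (ts 1)
      rw [holds_edge a e i j hi hj, holds_edge b e i j hi hj]
      -- Threshold `2` makes the differences `1` and `-1` and the value `0` exact.
      have h := h.weaken (one_lt_pow_mul_threshold N _)
      have h1 := h.1 i
      have h2 := h.1 j
      have h3 := h.2 i j
      fin_cases e
      · change a j = a i + 1 ↔ b j = b i + 1
        rcases h3 with h | ⟨_, h⟩ <;> push_cast at h <;> omega
      · change a i = a j + 1 ↔ b i = b j + 1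
        rcases h3 with h | ⟨_, h⟩ <;> push_cast at h <;> omega
      · change (a i = 0 ∧ a j = 0) ↔ (b i = 0 ∧ b j = 0)
        rcases h1 with h | ⟨_, h⟩ <;> rcases h2 with h' | ⟨_, h'⟩ <;> push_cast at h h' <;> omega
    | reach r =>
      obtain ⟨i, hi⟩ := exists_eq_var (ts 0)
      obtain ⟨j, hj⟩ := exists_eq_var (ts 1)
      rw [holds_reach a r i j hi hj, holds_reach b r i j hi hj]
      refine counterReach_congr_of_tupleSimilar ?_ h i j
      refine le_trans ?_ hφ
      exact (Nat.left_le_pair _ _).trans (Nat.right_le_pair _ _)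
  | imp φ ψ h1 h2 =>
    have hc1 : codeFormula φ ≤ codeFormula (φ.imp ψ) :=
      (Nat.left_le_pair _ _).trans (Nat.right_le_pair _ _)
    have hc2 : codeFormula ψ ≤ codeFormula (φ.imp ψ) :=
      (Nat.right_le_pair _ _).trans (Nat.right_le_pair _ _)
    rw [holds_imp, holds_imp, h1 (hc1.trans hφ) (h.weaken ?_), h2 (hc2.trans hφ) (h.weaken ?_)]
    · exact Nat.mul_le_mul_right _ (Nat.pow_le_pow_right (by omega) hc2)
    · exact Nat.mul_le_mul_right _ (Nat.pow_le_pow_right (by omega) hc1)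
  | all φ ih =>
    have hc : codeFormula φ < codeFormula φ.all := by
      have := Nat.add_le_pair 5 (codeFormula φ)
      rw [codeFormula]
      omega
    have hpos : 0 < 4 ^ codeFormula φ * threshold N :=
      lt_of_lt_of_le (Nat.succ_pos _) (le_pow_mul_threshold N _)
    have h := h.weaken (two_mul_add_le hc)
    rw [holds_all, holds_all]
    constructor
    · intro hall x
      obtain ⟨y, hy, -⟩ := h.symm.exists_snoc hpos (period_pos N) x
      exact (ih (by omega) hy).2 (hall y)
    · intro hall x
      obtain ⟨y, hy, -⟩ := h.exists_snoc hpos (period_pos N) x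
      exact (ih (by omega) hy).2 (hall y)

/-- The growth of the range of quantifiers. -/
def range (N : ℕ) : ℕ := 4 ^ N * threshold N + period N

/-- Over the tuple `a`, every number is similar to one at most `range N` above `0` or a member of
`a`, and `holds_congr` transfers the truth of `φ` between them. -/
theorem holds_all_iff_bounded {n N W : ℕ} (φ : (lang (Fin 3)).BoundedFormula Empty (n + 1))
    (hφ : codeFormula φ ≤ N) {a : Fin n → ℕ} (ha : ∀ i, a i ≤ W) :
    Holds φ.all a ↔ ∀ x ≤ W + range N, Holds φ (Fin.snoc a x : Fin (n + 1) → ℕ) := by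
  rw [holds_all]
  refine ⟨fun h x _ => h x, fun h x => ?_⟩
  have hpos : 0 < 4 ^ codeFormula φ * threshold N :=
    lt_of_lt_of_le (Nat.succ_pos _) (le_pow_mul_threshold N _)
  obtain ⟨y, hy, hle⟩ := (TupleSimilar.refl a).exists_snoc hpos (period_pos N) x
  refine (holds_congr φ hφ hy).2 (h y ?_)
  have hpow : 4 ^ codeFormula φ * threshold N ≤ 4 ^ N * threshold N :=
    Nat.mul_le_mul_right _ (Nat.pow_le_pow_right (by omega) hφ)
  unfold range
  rcases hle with hle | ⟨i, hle⟩
  · omega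
  · have := ha i
    omega

end FOReg
-- Evaluation as a primitive recursion
namespace FOReg

open Encodable

/-- A recursive definition by Boolean formulas in disjunctive normal form is primitive
recursive. -/
theorem exists_primrec_eval {β : Type} [Primcodable β] {clauses : β → List (List (β × Bool))}
    (hclauses : Primrec clauses) {rank : β → ℕ} (hrank : Primrec rank)
    (hlt : ∀ b, ∀ cl ∈ clauses b, ∀ l ∈ cl, rank l.1 < rank b) :
    ∃ val : β → Bool, Primrec val ∧
      ∀ b, val b = true ↔ ∃ cl ∈ clauses b, ∀ l ∈ cl, val l.1 = l.2 := by
  classical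
  let val : β → Bool := (measure rank).wf.fix fun b ih =>
    decide (∃ cl ∈ clauses b, ∀ l ∈ cl, ∀ h : rank l.1 < rank b, ih l.1 h = l.2)
  have hval : ∀ b, val b = true ↔ ∃ cl ∈ clauses b, ∀ l ∈ cl, val l.1 = l.2 := by
    intro b
    have := (measure rank).wf.fix_eq (fun b ih =>
      decide (∃ cl ∈ clauses b, ∀ l ∈ cl, ∀ h : rank l.1 < rank b, ih l.1 h = l.2)) b
    change val b = _ at this
    rw [this, decide_eq_true_iff]
    refine exists_congr fun cl => and_congr_right fun hcl => forall₂_congr fun l hl => ?_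
    exact ⟨fun h => h (hlt b cl hcl l hl), fun h _ => h⟩
  refine ⟨val, ?_, hval⟩
  have hmem : PrimrecRel fun (l : β × Bool) (L : List (β × Bool)) => l ∈ L :=
    PrimrecRel.of_eq (PrimrecRel.comp₂ (PrimrecRel.exists_mem_list Primrec.eq)
      Primrec₂.right Primrec₂.left) (by simp)
  have hsat : PrimrecRel fun (C : List (List (β × Bool))) (L : List (β × Bool)) =>
      ∃ cl ∈ C, ∀ l ∈ cl, l ∈ L := hmem.forall_mem_list.exists_mem_list
  have hsat' : PrimrecRel fun (b : β) (L : List (β × Bool)) =>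
      ∃ cl ∈ clauses b, ∀ l ∈ cl, l ∈ L :=
    PrimrecRel.comp₂ hsat (hclauses.comp₂ Primrec₂.left) Primrec₂.right
  -- Each task is computed together with its value: the list of results for the subtasks then
  -- consists of the true literals, and satisfaction is membership in it.
  have hpair : Primrec fun b => (b, val b) := by
    refine Primrec.nat_omega_rec' (m := rank) (l := fun b => (clauses b).flatten.map Prod.fst)
      (g := fun b L => some (b, decide (∃ cl ∈ clauses b, ∀ l ∈ cl, l ∈ L))) _ hrank
      (Primrec.list_map (Primrec.list_flatten.comp hclauses) (Primrec.fst.comp₂ Primrec₂.right))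
      (Primrec.option_some.comp₂ (Primrec₂.pair.comp₂ Primrec₂.left hsat'.decide)) ?_ ?_
    · intro b b' hb'
      obtain ⟨l, hl, rfl⟩ := List.mem_map.1 hb'
      obtain ⟨cl, hcl, hl⟩ := List.mem_flatten.1 hl
      exact hlt b cl hcl l hl
    · intro b
      congr 2
      rw [Bool.eq_iff_iff, decide_eq_true_iff, hval]
      refine exists_congr fun cl => and_congr_right fun hcl => forall₂_congr fun l hl => ?_
      rw [List.map_map, List.mem_map]
      constructor
      · rintro ⟨l', -, rfl⟩
        rfl
      · intro h
        exact ⟨l, List.mem_flatten.2 ⟨cl, hcl, hl⟩, Prod.ext rfl h⟩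
  exact Primrec.snd.comp hpair

/-- The tasks of the evaluation procedure: a pair of parameters `(C, B)`, where `C` is the growth of
the range of quantifiers and `B` is the bound on paths; the kind of the task (`0` for a formula, `1`
for a regular expression, `j + 2` for at most `2 ^ j` iterations of a regular expression); a Gödel
number; and the values of the variables. -/
abbrev Task : Type := (ℕ × ℕ) × ℕ × ℕ × List ℕ

/-- A condition as a disjunction of conjunctions. -/
def condClauses (t : Bool) : List (List (Task × Bool)) := bif t then [[]] else []

/-- The condition that there is an intermediate point. -/
def compClauses (p : ℕ × ℕ) (k c d : ℕ) (e : List ℕ) : List (List (Task × Bool)) :=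
  (List.range (p.2 + 1)).map fun z =>
    [((p, k, c, [e.getD 0 0, z]), true), ((p, k, d, [z, e.getD 1 0]), true)]

/-- The condition that a formula holds for all values of the next variable in its range. -/
def allClauses (p : ℕ × ℕ) (d : ℕ) (e : List ℕ) : List (List (Task × Bool)) :=
  [(List.range ((e.length + 1) * p.1 + 1)).map fun x => ((p, 0, d, e ++ [x]), true)]

/-- Test for the edges of the counter. -/
def edgeTest (a x y : ℕ) : Bool :=
  decide ((a = 0 ∧ y = x + 1) ∨ (a = 1 ∧ x = y + 1) ∨ (a = 2 ∧ x = 0 ∧ y = 0))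

/-- Reduction of the evaluation of a formula to simpler tasks. -/
def formulaClauses (p : ℕ × ℕ) (c : ℕ) (e : List ℕ) : List (List (Task × Bool)) :=
  let t := c.unpair.1
  let d := c.unpair.2
  let u := d.unpair.1
  let v := d.unpair.2
  let x := e.getD v.unpair.1 0
  let y := e.getD v.unpair.2 0
  if t = 1 then condClauses (decide (e.getD u 0 = e.getD v 0))
  else if t = 2 then condClauses (edgeTest u x y)
  else if t = 3 then [[((p, 1, u, [x, y]), true)]]
  else if t = 4 then [[((p, 0, u, e), false)], [((p, 0, v, e), true)]]
  else if t = 5 then allClauses p d e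
  else []

/-- The number of the kind of tasks that stands for arbitrary many iterations. -/
def starKind (B : ℕ) : ℕ := 2 ^ ((B + 1) * (B + 1)) + 2

/-- Reduction of the evaluation of a regular expression to simpler tasks. -/
def regexClauses (p : ℕ × ℕ) (c : ℕ) (e : List ℕ) : List (List (Task × Bool)) :=
  let t := c.unpair.1
  let d := c.unpair.2
  let u := d.unpair.1
  let v := d.unpair.2
  let x := e.getD 0 0
  let y := e.getD 1 0
  if t = 1 then condClauses (decide (x = y))
  else if t = 2 then condClauses (edgeTest d x y && decide (x ≤ p.2) && decide (y ≤ p.2))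
  else if t = 3 then [[((p, 1, u, e), true)], [((p, 1, v, e), true)]]
  else if t = 4 then compClauses p 1 u v e
  else if t = 5 then [[((p, starKind p.2, d, e), true)]]
  else []

/-- Reduction of the evaluation of iterations of a regular expression to simpler tasks. -/
def starClauses (p : ℕ × ℕ) (k c : ℕ) (e : List ℕ) : List (List (Task × Bool)) :=
  if k = 2 then
    if e.getD 0 0 = e.getD 1 0 then [[]] else [[((p, 1, c, e), true)]]
  else compClauses p (k - 1) c c e

/-- Reduction of a task to simpler tasks. -/
def taskClauses (b : Task) : List (List (Task × Bool)) :=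
  if b.2.1 = 0 then formulaClauses b.1 b.2.2.1 b.2.2.2
  else if b.2.1 = 1 then regexClauses b.1 b.2.2.1 b.2.2.2
  else starClauses b.1 b.2.1 b.2.2.1 b.2.2.2

/-- The reduction of tasks decreases their rank. -/
def taskRank (b : Task) : ℕ := b.2.2.1 * (starKind b.1.2 + 1) + b.2.1

theorem primrec_pow {α : Type*} [Primcodable α] {f g : α → ℕ} (hf : Primrec f) (hg : Primrec g) :
    Primrec fun a => f a ^ g a := by
  refine (Primrec.nat_rec' hg (.const 1)
    (h := fun a p => p.2 * f a) (Primrec.nat_mul.comp (Primrec.snd.comp Primrec.snd)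
      (hf.comp Primrec.fst))).of_eq fun a => ?_
  induction g a with
  | zero => rfl
  | succ n ih => rw [pow_succ, ← ih]

theorem primrec_factorial : Primrec Nat.factorial := by
  refine (Primrec.nat_rec₁ 1 (f := fun n p => (n + 1) * p) (Primrec.nat_mul.comp
    (Primrec.succ.comp Primrec.fst) Primrec.snd)).of_eq fun n => ?_
  induction n with
  | zero => rfl
  | succ n ih => rw [Nat.factorial_succ, ← ih]

theorem primrec_starKind : Primrec starKind :=
  Primrec.nat_add.comp (primrec_pow (.const 2)
    (Primrec.nat_mul.comp Primrec.succ Primrec.succ)) (.const 2)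

section

variable {α : Type*} [Primcodable α] {p : α → ℕ × ℕ} {k c d : α → ℕ} {e : α → List ℕ}

theorem primrec_literal (hp : Primrec p) (hk : Primrec k) (hc : Primrec c) (he : Primrec e)
    (s : Bool) : Primrec fun a => (((p a, k a, c a, e a), s) : Task × Bool) :=
  .pair (.pair hp (.pair hk (.pair hc he))) (.const s)

theorem primrec_singleton {γ : Type*} [Primcodable γ] {f : α → γ} (hf : Primrec f) :
    Primrec fun a => [f a] :=
  Primrec.list_cons.comp hf (.const [])

theorem primrec_doubleton {γ : Type*} [Primcodable γ] {f g : α → γ} (hf : Primrec f)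
    (hg : Primrec g) : Primrec fun a => [f a, g a] :=
  Primrec.list_cons.comp hf (primrec_singleton hg)

theorem primrec_condClauses {t : α → Bool} (ht : Primrec t) :
    Primrec fun a => condClauses (t a) :=
  Primrec.cond ht (.const _) (.const _)

theorem primrec_getD (he : Primrec e) (hk : Primrec k) : Primrec fun a => (e a).getD (k a) 0 :=
  (Primrec.list_getD 0).comp he hk

theorem primrec_compClauses (hp : Primrec p) (hk : Primrec k) (hc : Primrec c) (hd : Primrec d)
    (he : Primrec e) : Primrec fun a => compClauses (p a) (k a) (c a) (d a) (e a) := by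
  refine Primrec.list_map (Primrec.list_range.comp (Primrec.succ.comp (Primrec.snd.comp hp))) ?_
  refine primrec_doubleton
    (primrec_literal (hp.comp .fst) (hk.comp .fst) (hc.comp .fst) (primrec_doubleton ?_ .snd) _)
    (primrec_literal (hp.comp .fst) (hk.comp .fst) (hd.comp .fst) (primrec_doubleton .snd ?_) _)
  · exact primrec_getD (he.comp .fst) (.const 0)
  · exact primrec_getD (he.comp .fst) (.const 1)

theorem primrec_allClauses (hp : Primrec p) (hd : Primrec d) (he : Primrec e) :
    Primrec fun a => allClauses (p a) (d a) (e a) := by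
  refine primrec_singleton (Primrec.list_map (Primrec.list_range.comp (Primrec.succ.comp
    (Primrec.nat_mul.comp (Primrec.succ.comp (Primrec.list_length.comp he))
      (Primrec.fst.comp hp)))) ?_)
  exact primrec_literal (hp.comp .fst) (.const 0) (hd.comp .fst)
    (Primrec.list_append.comp (he.comp .fst) (primrec_singleton .snd)) _

theorem primrec_edgeTest (hk : Primrec k) (hc : Primrec c) (hd : Primrec d) :
    Primrec fun a => edgeTest (k a) (c a) (d a) := by
  refine PrimrecPred.decide (.or (.and ?_ ?_) (.or (.and ?_ ?_) (.and ?_ (.and ?_ ?_))))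
  · exact Primrec.eq.comp hk (.const 0)
  · exact Primrec.eq.comp hd (Primrec.succ.comp hc)
  · exact Primrec.eq.comp hk (.const 1)
  · exact Primrec.eq.comp hc (Primrec.succ.comp hd)
  · exact Primrec.eq.comp hk (.const 2)
  · exact Primrec.eq.comp hc (.const 0)
  · exact Primrec.eq.comp hd (.const 0)

theorem primrec_formulaClauses (hp : Primrec p) (hc : Primrec c) (he : Primrec e) :
    Primrec fun a => formulaClauses (p a) (c a) (e a) := by
  have hl : ∀ {f : α → ℕ}, Primrec f → Primrec fun a => (f a).unpair.1 :=
    fun h => Primrec.fst.comp (Primrec.unpair.comp h)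
  have hr : ∀ {f : α → ℕ}, Primrec f → Primrec fun a => (f a).unpair.2 :=
    fun h => Primrec.snd.comp (Primrec.unpair.comp h)
  have ht : ∀ n, PrimrecPred fun a => (c a).unpair.1 = n :=
    fun n => Primrec.eq.comp (hl hc) (.const n)
  have hd := hr hc
  have hu := hl hd
  have hv := hr hd
  have hx := primrec_getD he (hl hv)
  have hy := primrec_getD he (hr hv)
  refine Primrec.ite (ht 1) (primrec_condClauses (PrimrecPred.decide
    (Primrec.eq.comp (primrec_getD he hu) (primrec_getD he hv)))) ?_
  refine Primrec.ite (ht 2) (primrec_condClauses (primrec_edgeTest hu hx hy)) ?_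
  refine Primrec.ite (ht 3) (primrec_singleton (primrec_singleton
    (primrec_literal hp (.const 1) hu (primrec_doubleton hx hy) _))) ?_
  refine Primrec.ite (ht 4) (primrec_doubleton
    (primrec_singleton (primrec_literal hp (.const 0) hu he _))
    (primrec_singleton (primrec_literal hp (.const 0) hv he _))) ?_
  exact Primrec.ite (ht 5) (primrec_allClauses hp hd he) (.const _)

theorem primrec_regexClauses (hp : Primrec p) (hc : Primrec c) (he : Primrec e) :
    Primrec fun a => regexClauses (p a) (c a) (e a) := by
  have hl : ∀ {f : α → ℕ}, Primrec f → Primrec fun a => (f a).unpair.1 :=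
    fun h => Primrec.fst.comp (Primrec.unpair.comp h)
  have hr : ∀ {f : α → ℕ}, Primrec f → Primrec fun a => (f a).unpair.2 :=
    fun h => Primrec.snd.comp (Primrec.unpair.comp h)
  have ht : ∀ n, PrimrecPred fun a => (c a).unpair.1 = n :=
    fun n => Primrec.eq.comp (hl hc) (.const n)
  have hd := hr hc
  have hu := hl hd
  have hv := hr hd
  have hx := primrec_getD he (.const 0)
  have hy := primrec_getD he (.const 1)
  have hB := Primrec.snd.comp hp
  refine Primrec.ite (ht 1) (primrec_condClauses (PrimrecPred.decide (Primrec.eq.comp hx hy))) ?_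
  refine Primrec.ite (ht 2) (primrec_condClauses (Primrec.and.comp (Primrec.and.comp
    (primrec_edgeTest hd hx hy) (PrimrecPred.decide (Primrec.nat_le.comp hx hB)))
    (PrimrecPred.decide (Primrec.nat_le.comp hy hB)))) ?_
  refine Primrec.ite (ht 3) (primrec_doubleton
    (primrec_singleton (primrec_literal hp (.const 1) hu he _))
    (primrec_singleton (primrec_literal hp (.const 1) hv he _))) ?_
  refine Primrec.ite (ht 4) (primrec_compClauses hp (.const 1) hu hv he) ?_
  exact Primrec.ite (ht 5) (primrec_singleton (primrec_singleton
    (primrec_literal hp (primrec_starKind.comp hB) hd he _))) (.const _)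

theorem primrec_starClauses (hp : Primrec p) (hk : Primrec k) (hc : Primrec c) (he : Primrec e) :
    Primrec fun a => starClauses (p a) (k a) (c a) (e a) := by
  refine Primrec.ite (Primrec.eq.comp hk (.const 2)) ?_
    (primrec_compClauses hp (Primrec.pred.comp hk) hc hc he)
  exact Primrec.ite (Primrec.eq.comp (primrec_getD he (.const 0)) (primrec_getD he (.const 1)))
    (.const _) (primrec_singleton (primrec_singleton (primrec_literal hp (.const 1) hc he _)))

end

theorem primrec_taskClauses : Primrec taskClauses := by
  have hk : Primrec fun b : Task => b.2.1 := Primrec.fst.comp Primrec.snd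
  have hc : Primrec fun b : Task => b.2.2.1 := Primrec.fst.comp (Primrec.snd.comp Primrec.snd)
  have he : Primrec fun b : Task => b.2.2.2 := Primrec.snd.comp (Primrec.snd.comp Primrec.snd)
  exact Primrec.ite (Primrec.eq.comp hk (.const 0)) (primrec_formulaClauses .fst hc he)
    (Primrec.ite (Primrec.eq.comp hk (.const 1)) (primrec_regexClauses .fst hc he)
      (primrec_starClauses .fst hk hc he))

theorem primrec_taskRank : Primrec taskRank :=
  Primrec.nat_add.comp (Primrec.nat_mul.comp (Primrec.fst.comp (Primrec.snd.comp Primrec.snd))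
    (Primrec.succ.comp (primrec_starKind.comp (Primrec.snd.comp Primrec.fst))))
    (Primrec.fst.comp Primrec.snd)

/-- The rank orders tasks by Gödel number first and kind second; a smaller number outweighs any new
kind up to `starKind p.2`. -/
theorem taskRank_lt {p : ℕ × ℕ} {k k' c c' : ℕ} {e e' : List ℕ} (hc : c' < c)
    (hk : k' ≤ starKind p.2) : taskRank (p, k', c', e') < taskRank (p, k, c, e) := by
  have : (c' + 1) * (starKind p.2 + 1) ≤ c * (starKind p.2 + 1) := Nat.mul_le_mul_right _ hc
  rw [Nat.succ_mul] at this
  simp only [taskRank]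
  omega

theorem taskRank_lt_of_mem {b : Task} {cl : List (Task × Bool)} (hcl : cl ∈ taskClauses b)
    {l : Task × Bool} (hl : l ∈ cl) : taskRank l.1 < taskRank b := by
  obtain ⟨p, k, c, e⟩ := b
  have hd : c.unpair.1 ≠ 0 → c.unpair.2 < c := by
    intro h
    have := Nat.add_le_pair c.unpair.1 c.unpair.2
    rw [Nat.pair_unpair] at this
    omega
  have hu := Nat.unpair_left_le c.unpair.2
  have hv := Nat.unpair_right_le c.unpair.2
  have hs : 2 ≤ starKind p.2 := Nat.le_add_left _ _
  have hcond : ∀ {t}, cl ∈ condClauses t → False := by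
    rintro (_ | _) h <;> simp [condClauses] at h
    subst h
    simp at hl
  have hcomp : ∀ {k c d}, cl ∈ compClauses p k c d e →
      ∃ e', l.1 = (p, k, c, e') ∨ l.1 = (p, k, d, e') := by
    intro k c d h
    obtain ⟨z, -, rfl⟩ := List.mem_map.1 h
    simp only [List.mem_cons, List.not_mem_nil, or_false] at hl
    rcases hl with rfl | rfl
    · exact ⟨_, .inl rfl⟩
    · exact ⟨_, .inr rfl⟩
  unfold taskClauses at hcl
  simp only at hcl
  split_ifs at hcl with h0 h1
  · unfold formulaClauses at hcl
    simp only at hcl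
    split_ifs at hcl with h1 h2 h3 h4 h5
    · exact (hcond hcl).elim
    · exact (hcond hcl).elim
    · have := hd (by omega)
      simp only [List.mem_singleton] at hcl
      subst hcl
      simp only [List.mem_singleton] at hl
      subst hl
      exact taskRank_lt (by omega) (by omega)
    · have := hd (by omega)
      simp only [List.mem_cons, List.not_mem_nil, or_false] at hcl
      rcases hcl with rfl | rfl <;> simp only [List.mem_singleton] at hl <;> subst hl <;>
        exact taskRank_lt (by omega) (by omega)
    · have := hd (by omega)
      simp only [allClauses, List.mem_singleton] at hcl
      subst hcl
      obtain ⟨x, -, rfl⟩ := List.mem_map.1 hl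
      exact taskRank_lt (by omega) (by omega)
    · simp at hcl
  · unfold regexClauses at hcl
    simp only at hcl
    split_ifs at hcl with h1 h2 h3 h4 h5
    · exact (hcond hcl).elim
    · exact (hcond hcl).elim
    · have := hd (by omega)
      simp only [List.mem_cons, List.not_mem_nil, or_false] at hcl
      rcases hcl with rfl | rfl <;> simp only [List.mem_singleton] at hl <;> subst hl <;>
        exact taskRank_lt (by omega) (by omega)
    · have := hd (by omega)
      obtain ⟨e', h | h⟩ := hcomp hcl <;> rw [h] <;> exact taskRank_lt (by omega) (by omega)
    · have := hd (by omega)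
      simp only [List.mem_singleton] at hcl
      subst hcl
      simp only [List.mem_singleton] at hl
      subst hl
      exact taskRank_lt (by omega) le_rfl
    · simp at hcl
  · unfold starClauses at hcl
    split_ifs at hcl with h2 h3
    · simp only [List.mem_singleton] at hcl
      subst hcl
      simp at hl
    · simp only [List.mem_singleton] at hcl
      subst hcl
      simp only [List.mem_singleton] at hl
      subst hl
      simp only [taskRank]
      omega
    · obtain ⟨e', h | h⟩ := hcomp hcl <;> rw [h] <;> simp only [taskRank] <;> omega

end FOReg
namespace FOReg

/-! ### Correctness of the evaluation -/

open Relation FirstOrder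

/-- The relation of being connected by at most `2 ^ j` steps of `R`, for numbers up to `B`. -/
def doubling (B : ℕ) (R : ℕ → ℕ → Prop) : ℕ → ℕ → ℕ → Prop
  | 0, x, y => x = y ∨ R x y
  | j + 1, x, y => ∃ z ≤ B, doubling B R j x z ∧ doubling B R j z y

/-- On the numbers up to `B` the relations `doubling B R j` increase and each determines the next,
so they are stable once `j` reaches the number of relations. The stable one is closed under steps of
`R`. The bound is crude, but only computability matters. -/
theorem doubling_iff_reflTransGen {B : ℕ} {R : ℕ → ℕ → Prop}
    (hR : ∀ x y, x ≤ B → R x y → y ≤ B) {x y : ℕ} (hx : x ≤ B) (hy : y ≤ B) :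
    doubling B R (2 ^ ((B + 1) * (B + 1))) x y ↔ ReflTransGen R x y := by
  constructor
  · generalize 2 ^ ((B + 1) * (B + 1)) = j
    intro h
    induction j generalizing x y with
    | zero =>
      rcases h with rfl | h
      · exact .refl
      · exact .single h
    | succ j ih =>
      obtain ⟨z, hz, h1, h2⟩ := h
      exact (ih hx hz h1).trans (ih hz hy h2)
  · let s : ℕ → Fin (B + 1) → Fin (B + 1) → Prop := fun j a b => doubling B R j a b
    have hsucc : ∀ j a b, s (j + 1) a b ↔ ∃ c, s j a c ∧ s j c b := by
      intro j a b
      constructor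
      · rintro ⟨z, hz, h1, h2⟩
        exact ⟨⟨z, by omega⟩, h1, h2⟩
      · rintro ⟨c, h1, h2⟩
        exact ⟨c, by omega, h1, h2⟩
    have hrefl : ∀ j a, s j a a := by
      intro j
      induction j with
      | zero => exact fun a => .inl rfl
      | succ j ih => exact fun a => (hsucc j a a).2 ⟨a, ih a, ih a⟩
    have hmono : Monotone s :=
      monotone_nat_of_le_succ fun j a b h => (hsucc j a b).2 ⟨b, h, hrefl j b⟩
    have hle := seq_le_of_monotone (s := s) (fun i j h => by
      funext a b
      rw [eq_iff_iff, hsucc, hsucc, h]) (card_relations_le (Nat.card_fin (B + 1)).le) hmono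
    intro h
    suffices H : ∀ y, ReflTransGen R x y → ∃ h : y < B + 1,
        s (2 ^ ((B + 1) * (B + 1))) ⟨x, by omega⟩ ⟨y, h⟩ by
      obtain ⟨_, h⟩ := H y h
      exact h
    intro y h
    induction h with
    | refl => exact ⟨by omega, hrefl _ _⟩
    | @tail y z _ hyz ih =>
      obtain ⟨hy, ih⟩ := ih
      have hz : z < B + 1 := Nat.lt_succ_of_le (hR y z (by omega) hyz)
      refine ⟨hz, hle _ _ _ ((hsucc _ _ _).2 ⟨⟨y, hy⟩, ih, ?_⟩)⟩
      exact hmono (Nat.zero_le _) _ _ (.inr hyz)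

theorem boundedReach_le {B : ℕ} {r : RegularExpression (Fin 3)} {x y : ℕ} (hx : x ≤ B)
    (h : boundedReach B r x y) : y ≤ B := by
  obtain ⟨l, -, hp⟩ := h
  induction l generalizing x with
  | nil =>
    obtain rfl : x = y := hp
    exact hx
  | cons a l ih =>
    obtain ⟨u, hu, hp⟩ := hp
    exact ih hu.2.1 hp

theorem edgeTest_iff (a : Fin 3) (x y : ℕ) :
    edgeTest (Encodable.encode a) x y = true ↔ counter.E a x y := by
  rw [edgeTest, decide_eq_true_iff, show Encodable.encode a = a.val from rfl]
  fin_cases a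
  · change _ ↔ y = x + 1
    simp
  · change _ ↔ x = y + 1
    simp
  · change _ ↔ x = 0 ∧ y = 0
    simp

section Evaluation

variable {val : Task → Bool}

theorem exists_mem_singleton {b : Task} {s : Bool} :
    (∃ cl ∈ ([ [(b, s)] ] : List (List (Task × Bool))), ∀ l ∈ cl, val l.1 = l.2) ↔ val b = s := by
  simp only [List.mem_singleton, exists_eq_left, forall_eq]

theorem exists_mem_doubleton {b b' : Task} {s s' : Bool} :
    (∃ cl ∈ ([ [(b, s)], [(b', s')] ] : List (List (Task × Bool))), ∀ l ∈ cl, val l.1 = l.2) ↔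
      val b = s ∨ val b' = s' := by
  simp only [List.mem_cons, List.not_mem_nil, or_false, exists_eq_or_imp, exists_eq_left, forall_eq]

theorem exists_mem_condClauses {t : Bool} :
    (∃ cl ∈ condClauses t, ∀ l ∈ cl, val l.1 = l.2) ↔ t = true := by
  cases t <;> simp [condClauses]

theorem exists_mem_compClauses {p : ℕ × ℕ} {k c d x y : ℕ} :
    (∃ cl ∈ compClauses p k c d [x, y], ∀ l ∈ cl, val l.1 = l.2) ↔
      ∃ z ≤ p.2, val (p, k, c, [x, z]) = true ∧ val (p, k, d, [z, y]) = true := by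
  simp only [compClauses, List.mem_map, List.mem_range, Nat.lt_succ_iff, exists_exists_and_eq_and,
    List.mem_cons, List.not_mem_nil, or_false, forall_eq_or_imp, forall_eq, List.getD_cons_zero,
    List.getD_cons_succ]

theorem val_star (hval : ∀ b, val b = true ↔ ∃ cl ∈ taskClauses b, ∀ l ∈ cl, val l.1 = l.2)
    {p : ℕ × ℕ} {c : ℕ} {R : ℕ → ℕ → Prop}
    (hR : ∀ x y, x ≤ p.2 → y ≤ p.2 → (val (p, 1, c, [x, y]) = true ↔ R x y)) (j : ℕ) {x y : ℕ}
    (hx : x ≤ p.2) (hy : y ≤ p.2) :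
    val (p, j + 2, c, [x, y]) = true ↔ doubling p.2 R j x y := by
  induction j generalizing x y with
  | zero =>
    rw [hval]
    by_cases hxy : x = y
    · simp [taskClauses, starClauses, doubling, hxy]
    · have : taskClauses (p, 0 + 2, c, [x, y]) = [ [((p, 1, c, [x, y]), true)] ] := by
        simp [taskClauses, starClauses, hxy]
      rw [this, exists_mem_singleton, hR x y hx hy]
      simp [doubling, hxy]
  | succ j ih =>
    rw [hval]
    have : taskClauses (p, j + 1 + 2, c, [x, y]) = compClauses p (j + 2) c c [x, y] := by
      simp [taskClauses, starClauses]
    rw [this, exists_mem_compClauses, doubling]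
    exact exists_congr fun z => and_congr_right fun hz => and_congr (ih hx hz) (ih hz hy)

/-- Paths of the bounded counter that start at most at `B` stay there, so searching for intermediate
points up to `B` is exact. -/
theorem val_regex (hval : ∀ b, val b = true ↔ ∃ cl ∈ taskClauses b, ∀ l ∈ cl, val l.1 = l.2)
    (p : ℕ × ℕ) (r : RegularExpression (Fin 3)) {x y : ℕ} (hx : x ≤ p.2) (hy : y ≤ p.2) :
    val (p, 1, codeRegex r, [x, y]) = true ↔ boundedReach p.2 r x y := by
  induction r generalizing x y with
  | zero =>
    rw [hval]
    refine iff_of_false ?_ (TransitionSystem.reach_zero _ _ _)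
    simp [taskClauses, regexClauses, codeRegex]
  | epsilon =>
    rw [hval]
    refine Iff.trans ?_ (TransitionSystem.reach_epsilon _ _ _).symm
    have : taskClauses (p, 1, codeRegex (.epsilon : RegularExpression (Fin 3)), [x, y]) =
        condClauses (decide (x = y)) := by
      simp [taskClauses, regexClauses, codeRegex]
    rw [this, exists_mem_condClauses, decide_eq_true_iff]
    exact Iff.rfl
  | char a =>
    rw [hval]
    refine Iff.trans ?_ (TransitionSystem.reach_char _ _ _ _).symm
    have : taskClauses (p, 1, codeRegex (.char a), [x, y]) =
        condClauses (edgeTest (Encodable.encode a) x y && decide (x ≤ p.2) && decide (y ≤ p.2)) := by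
      simp [taskClauses, regexClauses, codeRegex]
    rw [this, exists_mem_condClauses, Bool.and_eq_true, Bool.and_eq_true, edgeTest_iff]
    simp [boundedCounter, hx, hy]
  | plus r s hr hs =>
    rw [hval]
    refine Iff.trans ?_ (TransitionSystem.reach_plus _ _ _ _ _).symm
    refine Iff.trans ?_ (or_congr (hr hx hy) (hs hx hy))
    have : taskClauses (p, 1, codeRegex (.plus r s), [x, y]) =
        [ [((p, 1, codeRegex r, [x, y]), true)], [((p, 1, codeRegex s, [x, y]), true)] ] := by
      simp [taskClauses, regexClauses, codeRegex]
    rw [this, exists_mem_doubleton]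
  | comp r s hr hs =>
    rw [hval]
    refine Iff.trans ?_ (TransitionSystem.reach_comp _ _ _ _ _).symm
    have : taskClauses (p, 1, codeRegex (.comp r s), [x, y]) =
        compClauses p 1 (codeRegex r) (codeRegex s) [x, y] := by
      simp [taskClauses, regexClauses, codeRegex]
    rw [this, exists_mem_compClauses]
    constructor
    · rintro ⟨z, hz, h1, h2⟩
      exact ⟨z, (hr hx hz).1 h1, (hs hz hy).1 h2⟩
    · rintro ⟨z, h1, h2⟩
      have hz := boundedReach_le hx h1
      exact ⟨z, hz, (hr hx hz).2 h1, (hs hz hy).2 h2⟩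
  | star r hr =>
    rw [hval]
    refine Iff.trans ?_ (TransitionSystem.reach_star _ _ _ _).symm
    refine Iff.trans ?_ (doubling_iff_reflTransGen (fun x y hx h => boundedReach_le hx h) hx hy)
    refine Iff.trans ?_ (val_star hval (fun x y hx hy => hr hx hy) _ hx hy)
    have : taskClauses (p, 1, codeRegex (.star r), [x, y]) =
        [ [((p, starKind p.2, codeRegex r, [x, y]), true)] ] := by
      simp [taskClauses, regexClauses, codeRegex]
    rw [this, exists_mem_singleton, starKind]

/-- The bound on paths for the evaluation of formulas with Gödel number at most `N`. -/
def pathBound (N : ℕ) : ℕ := N * range N + 1 + 2 ^ ((2 * N + 2) * (2 * N + 2))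

/-- The `n` variables in scope have values up to `n * range N`, and each quantifier raises `n` by
one while lowering the Gödel number. So `n + codeFormula φ ≤ N` persists, all values stay below `N *
range N`, and `pathBound N` leaves the room needed for paths. -/
theorem val_formula (hval : ∀ b, val b = true ↔ ∃ cl ∈ taskClauses b, ∀ l ∈ cl, val l.1 = l.2)
    {n N : ℕ} (φ : (lang (Fin 3)).BoundedFormula Empty n) (hN : n + codeFormula φ ≤ N)
    {xs : Fin n → ℕ} (hxs : ∀ i, xs i ≤ n * range N) :
    val ((range N, pathBound N), 0, codeFormula φ, List.ofFn xs) = true ↔ Holds φ xs := by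
  have hget : ∀ {n} (xs : Fin n → ℕ) (i : Fin n), (List.ofFn xs).getD i 0 = xs i := by
    intro n xs i
    simp [List.getD]
  induction φ with
  | falsum =>
    rw [hval]
    refine iff_of_false ?_ (not_holds_falsum xs)
    simp [taskClauses, formulaClauses, codeFormula]
  | equal s t =>
    obtain ⟨i, rfl⟩ := exists_eq_var s
    obtain ⟨j, rfl⟩ := exists_eq_var t
    rw [hval, holds_equal]
    have : taskClauses ((range N, pathBound N), 0,
        codeFormula (.equal (.var (.inr i)) (.var (.inr j)) :
          (lang (Fin 3)).BoundedFormula Empty _), List.ofFn xs) =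
        condClauses (decide (xs i = xs j)) := by
      simp only [taskClauses, formulaClauses, codeFormula, codeTerm, Nat.unpair_pair, hget,
        if_true]
    rw [this, exists_mem_condClauses, decide_eq_true_iff]
  | rel R ts =>
    cases R with
    | edge a =>
      obtain ⟨i, hi⟩ := exists_eq_var (ts 0)
      obtain ⟨j, hj⟩ := exists_eq_var (ts 1)
      rw [hval, holds_edge xs a i j hi hj]
      have : taskClauses ((range N, pathBound N), 0,
          codeFormula (.rel (.edge a) ts : (lang (Fin 3)).BoundedFormula Empty _), List.ofFn xs) =
          condClauses (edgeTest (Encodable.encode a) (xs i) (xs j)) := by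
        simp [taskClauses, formulaClauses, codeFormula, codeTerm, hi, hj]
      rw [this, exists_mem_condClauses, edgeTest_iff]
    | reach r =>
      obtain ⟨i, hi⟩ := exists_eq_var (ts 0)
      obtain ⟨j, hj⟩ := exists_eq_var (ts 1)
      rw [hval, holds_reach xs r i j hi hj]
      have h1 : codeRegex r ≤ codeFormula (.rel (.reach r) ts :
          (lang (Fin 3)).BoundedFormula Empty _) :=
        (Nat.left_le_pair _ _).trans (Nat.right_le_pair _ _)
      have hle : ∀ i, xs i ≤ N * range N :=
        fun i => (hxs i).trans (Nat.mul_le_mul_right _ (by omega))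
      have hle' : N * range N ≤ pathBound N := by
        unfold pathBound
        rw [add_assoc]
        exact Nat.le_add_right _ _
      rw [counterReach_iff_boundedReach (K := 2 * N + 2) (by omega) (hle i) (hle j)
        (le_refl (pathBound N)), ← val_regex hval (range N, pathBound N) r ((hle i).trans hle')
        ((hle j).trans hle')]
      have : taskClauses ((range N, pathBound N), 0,
          codeFormula (.rel (.reach r) ts : (lang (Fin 3)).BoundedFormula Empty _), List.ofFn xs) =
          [ [(((range N, pathBound N), 1, codeRegex r, [xs i, xs j]), true)] ] := by
        simp [taskClauses, formulaClauses, codeFormula, codeTerm, hi, hj]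
      rw [this, exists_mem_singleton]
  | imp φ ψ h1 h2 =>
    have hc : codeFormula φ + codeFormula ψ ≤ codeFormula (φ.imp ψ) :=
      (Nat.add_le_pair _ _).trans (Nat.right_le_pair _ _)
    have h1 := h1 (by omega) hxs
    have h2 := h2 (by omega) hxs
    rw [hval, holds_imp]
    refine Iff.trans ?_ (imp_congr h1 h2)
    rw [imp_iff_not_or, Bool.not_eq_true]
    have : taskClauses ((range N, pathBound N), 0, codeFormula (φ.imp ψ), List.ofFn xs) =
        [ [(((range N, pathBound N), 0, codeFormula φ, List.ofFn xs), false)],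
          [(((range N, pathBound N), 0, codeFormula ψ, List.ofFn xs), true)] ] := by
      simp [taskClauses, formulaClauses, codeFormula]
    rw [this, exists_mem_doubleton]
  | @all n φ ih =>
    have hc : 5 + codeFormula φ ≤ codeFormula φ.all := Nat.add_le_pair 5 (codeFormula φ)
    rw [hval, holds_all_iff_bounded φ (N := N) (by omega) hxs, ← Nat.succ_mul]
    have hsnoc : ∀ x : ℕ, List.ofFn xs ++ [x] = List.ofFn (Fin.snoc xs x : Fin (n + 1) → ℕ) := by
      intro x
      rw [List.ofFn_succ']
      simp
    have : taskClauses ((range N, pathBound N), 0, codeFormula φ.all, List.ofFn xs) =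
        allClauses (range N, pathBound N) (codeFormula φ) (List.ofFn xs) := by
      simp [taskClauses, formulaClauses, codeFormula]
    rw [this]
    simp only [allClauses, List.mem_singleton, exists_eq_left, List.mem_map, List.mem_range,
      List.length_ofFn, Nat.lt_succ_iff, forall_exists_index, and_imp, hsnoc]
    have hsn : ∀ x ≤ (n + 1) * range N, ∀ i, (Fin.snoc xs x : Fin (n + 1) → ℕ) i ≤
        (n + 1) * range N := by
      intro x hx
      refine Fin.lastCases ?_ fun i => ?_
      · simpa using hx
      · simpa using (hxs i).trans (Nat.mul_le_mul_right _ (Nat.le_succ n))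
    constructor
    · intro h x hx
      exact (ih (by omega) (hsn x hx)).1 (h _ x hx rfl)
    · rintro h _ x hx rfl
      exact (ih (by omega) (hsn x hx)).2 (h x hx)

end Evaluation

theorem hasDecidableTheory_counter : counter.HasDecidableTheory := by
  obtain ⟨val, hprim, hval⟩ := exists_primrec_eval primrec_taskClauses primrec_taskRank
    (fun b cl hcl l hl => taskRank_lt_of_mem hcl hl)
  have hT : Primrec fun N : ℕ => 2 ^ ((2 * N + 2) * (2 * N + 2)) := by
    have : Primrec fun N : ℕ => 2 * N + 2 :=
      Primrec.nat_add.comp (Primrec.nat_mul.comp (.const 2) .id) (.const 2)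
    exact primrec_pow (.const 2) (Primrec.nat_mul.comp this this)
  have hM : Primrec period := primrec_factorial.comp hT
  have hrange : Primrec range :=
    Primrec.nat_add.comp (Primrec.nat_mul.comp (primrec_pow (.const 4) .id)
      (Primrec.nat_add.comp (Primrec.succ.comp hT) hM)) hM
  have hbound : Primrec pathBound :=
    Primrec.nat_add.comp (Primrec.succ.comp (Primrec.nat_mul.comp .id hrange)) hT
  -- The Gödel number of the sentence itself serves as the bound `N`.
  refine ⟨fun N => val ((range N, pathBound N), 0, N, []), ?_, fun φ => ?_⟩
  · exact (hprim.comp (.pair (.pair hrange hbound)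
      (.pair (.const 0) (.pair .id (.const []))))).to_comp
  · have := val_formula hval (N := codeFormula φ) φ (by omega) (xs := Fin.elim0) (fun i => i.elim0)
    rw [List.ofFn_zero] at this
    refine this.trans ?_
    unfold Holds TransitionSystem.Models Language.Sentence.Realize Language.Formula.Realize
    let := counter.toStructure
    exact iff_of_eq (congrArg₂ (Language.BoundedFormula.Realize (M := counter.V) φ)
      (Subsingleton.elim _ _) (Subsingleton.elim _ _))

end FOReg

theorem theorem3p2 :
    ∃ (k₁ k₂ : ℕ) (P₁ : FOReg.PDA (Fin k₁)) (P₂ : FOReg.PDA (Fin k₂)),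
      P₁.graph.HasDecidableTheory ∧ P₂.graph.HasDecidableTheory ∧
        ¬ (P₁.graph.asyncProduct P₂.graph).HasDecidableTheory := by
  have h := FOReg.counterIso.symm.hasDecidableTheory FOReg.hasDecidableTheory_counter
  -- The same automaton can be used twice, as `asyncProduct` makes the labels disjoint.
  refine ⟨3, 3, FOReg.counterPDA, FOReg.counterPDA, h, h, fun hp => ?_⟩
  exact FOReg.not_hasDecidableTheory_grid
    ((FOReg.counterIso.asyncProduct FOReg.counterIso).hasDecidableTheory hp)
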